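/- For a nonnegative integer $n$ with binary digits $\delta_j(n)\in\{0,1\}$, $n=\sum_{j\ge 0}\delta_j(n)2^j$, let $r(n)=\#\{j\ge 0:\delta_{j+1}(n)=\delta_j(n)=1\}$ be the number of (overlapping) occurrences of the block $11$ in the binary expansion of $n$, and let $|n|_{01}=\#\{j\ge 0:\delta_{j+1}(n)=0,\ \delta_j(n)=1\}$ be the number of maximal blocks of ones in it. Define $(v_t)_{t\ge 0}$ by $v_0=0$, $v_1=3/2$ and $$v_{4t}=v_{2t},\qquad v_{4t+2}=v_{2t+1}+1,\qquad v_{2t+1}=\frac{v_t+v_{t+1}}2+\frac34 .$$ **Theorem.** For every nonnegative integer $t$ and every integer $k$ the set $\{n\ge 0: r(n+t)-r(n)=k\}$ has an asymptotic density $c_t(k)$, that is, the limit $c_t(k)=\lim_{x\to\infty}\frac1x\#\{0\le n<x: r(n+t)-r(n)=k\}$ exists. Moreover, there are absolute constants $C$ and $N_0$, which can be taken to be nonnegative integers, such that for every nonnegative integer $t$ with $N:=|t|_{01}\ge N_0$ and for every integer $k$, $$\left|c_t(k)-\frac{1}{\sqrt{2\pi v_t}}\exp\left(-\frac{k^2}{2v_t}\right)\right|\le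 C\,\frac{(\log N)^2}{N}.$$ -/

import Mathlib

open Filter Topology

/-- `|n|_{11}`: the number of (overlapping) occurrences of the block `11` in the binary expansion
of `n`, that is, the number of `j` such that the binary digits of `n` at the places `j + 1` and `j`
are both `1`. (The digit at a place `j ≥ n` is `0`, see `mem_range_of_testBit`.) -/
def countOneOne (n : ℕ) : ℕ :=
  ((Finset.range n).filter fun j => n.testBit (j + 1) = true ∧ n.testBit j = true).card

/-- `|n|_{01}`: the number of occurrences of the block `01` in the binary expansion of `n`, padded
with `0`s to the left, that is, the number of `j` such that the binary digit of `n` at the place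
`j + 1` is `0` and the one at the place `j` is `1`. It is the number of maximal blocks of `1`s. -/
def countZeroOne (n : ℕ) : ℕ :=
  ((Finset.range n).filter fun j => n.testBit (j + 1) = false ∧ n.testBit j = true).card

/-- Restricting the places to `j < n` loses nothing. -/
theorem mem_range_of_testBit {n j : ℕ} (h : n.testBit j = true) : j ∈ Finset.range n :=
  Finset.mem_range.2 (lt_of_lt_of_le Nat.lt_two_pow_self (Nat.ge_two_pow_of_testBit h))

theorem countOneOne_eq_ncard (n : ℕ) :
    countOneOne n = {j : ℕ | n.testBit (j + 1) = true ∧ n.testBit j = true}.ncard := by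
  rw [countOneOne, ← Set.ncard_coe_finset]
  congr 1
  ext j
  simp only [Finset.coe_filter, Set.mem_ofPred_eq]
  exact ⟨fun h => h.2, fun h => ⟨mem_range_of_testBit h.2, h⟩⟩

theorem countZeroOne_eq_ncard (n : ℕ) :
    countZeroOne n = {j : ℕ | n.testBit (j + 1) = false ∧ n.testBit j = true}.ncard := by
  rw [countZeroOne, ← Set.ncard_coe_finset]
  congr 1
  ext j
  simp only [Finset.coe_filter, Set.mem_ofPred_eq]
  exact ⟨fun h => h.2, fun h => ⟨mem_range_of_testBit h.2, h⟩⟩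

/-- `d(t, n) = r(n + t) - r(n)`, an integer, where `r(n) = |n|_{11}`. -/
def blockDiff (t n : ℕ) : ℤ :=
  (countOneOne (n + t) : ℤ) - (countOneOne n : ℤ)

/-- The set `A` of nonnegative integers has an asymptotic density, and its value is `c`:
the proportion of elements of `A` among `0, …, x - 1` tends to `c` as `x → ∞`. -/
def HasAsymptoticDensity (A : Set ℕ) (c : ℝ) : Prop :=
  Tendsto (fun x : ℕ => ((A ∩ Set.Iio x).ncard : ℝ) / (x : ℝ)) atTop (𝓝 c)

/-- The sequence `v_t`: `v_0 = 0`, `v_1 = 3/2`, `v_{4t} = v_{2t}`, `v_{4t+2} = v_{2t+1} + 1`,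
`v_{2t+1} = (v_t + v_{t+1}) / 2 + 3/4`; see the lemmas below. -/
noncomputable def varianceSeq (t : ℕ) : ℝ :=
  if t = 0 then 0
  else if t = 1 then 3 / 2
  else if t % 4 = 0 then varianceSeq (t / 2)
  else if t % 4 = 2 then varianceSeq (t / 2) + 1
  else (varianceSeq (t / 2) + varianceSeq (t / 2 + 1)) / 2 + 3 / 4
termination_by t
decreasing_by all_goals omega

theorem varianceSeq_zero : varianceSeq 0 = 0 := by
  rw [varianceSeq, if_pos rfl]

theorem varianceSeq_one : varianceSeq 1 = 3 / 2 := by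
  rw [varianceSeq, if_neg one_ne_zero, if_pos rfl]

theorem varianceSeq_four_mul (t : ℕ) : varianceSeq (4 * t) = varianceSeq (2 * t) := by
  rcases Nat.eq_zero_or_pos t with rfl | ht
  · rfl
  · rw [varianceSeq, if_neg (by omega), if_neg (by omega), if_pos (by omega),
      show 4 * t / 2 = 2 * t by omega]

theorem varianceSeq_four_mul_add_two (t : ℕ) :
    varianceSeq (4 * t + 2) = varianceSeq (2 * t + 1) + 1 := by
  rw [varianceSeq, if_neg (by omega), if_neg (by omega), if_neg (by omega), if_pos (by omega),
    show (4 * t + 2) / 2 = 2 * t + 1 by omega]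

theorem varianceSeq_two_mul_add_one (t : ℕ) :
    varianceSeq (2 * t + 1) = (varianceSeq t + varianceSeq (t + 1)) / 2 + 3 / 4 := by
  rcases Nat.eq_zero_or_pos t with rfl | ht
  · simp only [mul_zero, zero_add, varianceSeq_zero, varianceSeq_one]
    norm_num
  · rw [varianceSeq, if_neg (by omega), if_neg (by omega), if_neg (by omega), if_neg (by omega),
      show (2 * t + 1) / 2 = t by omega]

/-! ### Digit recurrences -/

/-! Writing `n = 2 * m + e` turns `d(T, n)` into `d((T + e) / 2, m)` plus a bounded term depending
only on `T` mod 4, `e` and the parity of `m` (`blockDiff_two_mul_add`). Given the parity of `n`, the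
densities therefore satisfy a two-term averaging recursion (`levelDensity_eq`), and so do their
characteristic functions (`condChar_eq`).

Two estimates follow by induction on the shift. First, whenever `t % 4 = 1`, two of the sixteen
digit paths of length four reach the same state with gains differing by one, so they interfere. This
yields the decay `exp (-θ² N / 1000)` on `[-π, π]` (`norm_condChar_add_le`). Second, after centering
at the parity-conditional means, the two branches shift by opposite amounts `±s`, the conditional
variances obey the law of total variance (`condVar_eq`), and a Taylor expansion costs `O(|θ|³)` per
step. These costs can be charged to the growth of the variance, so the total error against the
Gaussian is `O(v |θ|³)` (`norm_centeredChar_sub_le`), uniformly in `t`.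

Finally `v` and `N` are of the same order, and Fourier inversion compares `c_t(k)` with the
Gaussian. Cutting at `θ² = 1000 log N / N`, the inner range contributes `O(N θ⁴) = O((log N)² / N)`
at the cutoff, and the outer range and the Gaussian tail contribute `O(1 / N)`. -/

theorem countOneOne_eq_sum {n M : ℕ} (h : n ≤ M) :
    countOneOne n = ∑ j ∈ Finset.range M,
      if n.testBit (j + 1) = true ∧ n.testBit j = true then 1 else 0 := by
  rw [← Finset.card_filter, countOneOne]
  congr 1
  ext j
  simp only [Finset.mem_filter]
  exact ⟨fun hj => ⟨Finset.mem_range.2 (lt_of_lt_of_le (Finset.mem_range.1 hj.1) h), hj.2⟩,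
    fun hj => ⟨mem_range_of_testBit hj.2.2, hj.2⟩⟩

theorem countZeroOne_eq_sum {n M : ℕ} (h : n ≤ M) :
    countZeroOne n = ∑ j ∈ Finset.range M,
      if n.testBit (j + 1) = false ∧ n.testBit j = true then 1 else 0 := by
  rw [← Finset.card_filter, countZeroOne]
  congr 1
  ext j
  simp only [Finset.mem_filter]
  exact ⟨fun hj => ⟨Finset.mem_range.2 (lt_of_lt_of_le (Finset.mem_range.1 hj.1) h), hj.2⟩,
    fun hj => ⟨mem_range_of_testBit hj.2.2, hj.2⟩⟩

theorem countOneOne_two_mul_add (n e : ℕ) (he : e < 2) :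
    countOneOne (2 * n + e) = countOneOne n + e * (n % 2) := by
  rw [countOneOne_eq_sum (n := 2 * n + e) (M := 2 * n + 2) (by omega),
    countOneOne_eq_sum (n := n) (M := 2 * n + 1) (by omega), Finset.sum_range_succ']
  have h : (2 * n + e) / 2 = n := by omega
  simp only [Nat.testBit_succ, h]
  congr 1
  have h1 : (2 * n + e) % 2 = e := by omega
  rcases Nat.mod_two_eq_zero_or_one n with hn | hn <;> interval_cases e <;>
    simp [Nat.testBit_zero, hn]

theorem countZeroOne_two_mul_add (n e : ℕ) (he : e < 2) :
    countZeroOne (2 * n + e) = countZeroOne n + e * (1 - n % 2) := by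
  rw [countZeroOne_eq_sum (n := 2 * n + e) (M := 2 * n + 2) (by omega),
    countZeroOne_eq_sum (n := n) (M := 2 * n + 1) (by omega), Finset.sum_range_succ']
  have h : (2 * n + e) / 2 = n := by omega
  simp only [Nat.testBit_succ, h]
  congr 1
  have h1 : (2 * n + e) % 2 = e := by omega
  rcases Nat.mod_two_eq_zero_or_one n with hn | hn <;> interval_cases e <;>
    simp [Nat.testBit_zero, hn]

/-- The contribution to `d(T, 2 * m + e)` of the last digit `e`, given the parity `μ` of `m`. -/
def digitGain (T e μ : ℕ) : ℤ :=
  (((T + e) % 2 * ((μ + (T + e) / 2) % 2) : ℕ) : ℤ) - ((e * μ : ℕ) : ℤ)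

/-- Adding `T` at the last digit leaves the digit `(T + e) % 2` and passes `(T + e) / 2` on to `m`;
the gain accounts for the pairs formed by the two lowest digits. -/
theorem blockDiff_two_mul_add (T m e : ℕ) (he : e < 2) :
    blockDiff T (2 * m + e) = blockDiff ((T + e) / 2) m + digitGain T e (m % 2) := by
  have h : 2 * m + e + T = 2 * (m + (T + e) / 2) + (T + e) % 2 := by omega
  rw [blockDiff, blockDiff, digitGain, h, countOneOne_two_mul_add _ _ (Nat.mod_lt _ two_pos),
    countOneOne_two_mul_add _ _ he, show (m + (T + e) / 2) % 2 = (m % 2 + (T + e) / 2) % 2 by omega]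
  push_cast
  ring

theorem blockDiff_zero (n : ℕ) : blockDiff 0 n = 0 := by
  simp [blockDiff]

/-- Starts the downward induction on `k` in the self-referential case `T = e = 1` of the existence
of densities. -/
theorem blockDiff_one_le (n : ℕ) : blockDiff 1 n ≤ 1 := by
  induction n using Nat.strong_induction_on with
  | _ n ih =>
    obtain ⟨m, e, he, rfl⟩ : ∃ m e, e < 2 ∧ n = 2 * m + e :=
      ⟨n / 2, n % 2, Nat.mod_lt _ two_pos, by omega⟩
    rw [blockDiff_two_mul_add _ _ _ he]
    interval_cases e
    · rcases Nat.mod_two_eq_zero_or_one m with hm | hm <;> simp [digitGain, blockDiff_zero, hm]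
    · have := ih m (by omega)
      rcases Nat.mod_two_eq_zero_or_one m with hm | hm <;> simp [digitGain, hm] <;> omega

/-! ### Asymptotic densities -/

theorem HasAsymptoticDensity.unique {A : Set ℕ} {c c' : ℝ} (h : HasAsymptoticDensity A c)
    (h' : HasAsymptoticDensity A c') : c = c' :=
  tendsto_nhds_unique h h'

theorem hasAsymptoticDensity_empty : HasAsymptoticDensity ∅ 0 := by
  simp [HasAsymptoticDensity]

theorem hasAsymptoticDensity_univ : HasAsymptoticDensity Set.univ 1 := by
  refine tendsto_const_nhds.congr' ?_
  filter_upwards [eventually_gt_atTop 0] with x hx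
  have : (Set.Iio x).ncard = x := by
    rw [← Finset.coe_Iio, Set.ncard_coe_finset, Nat.card_Iio]
  rw [Set.univ_inter, this, div_self (by positivity)]

theorem HasAsymptoticDensity.union {A B : Set ℕ} {a b : ℝ} (hA : HasAsymptoticDensity A a)
    (hB : HasAsymptoticDensity B b) (h : Disjoint A B) :
    HasAsymptoticDensity (A ∪ B) (a + b) := by
  refine (Tendsto.add hA hB).congr fun x => ?_
  rw [Set.union_inter_distrib_right, Set.ncard_union_eq
    (h.mono Set.inter_subset_left Set.inter_subset_left)
    ((Set.finite_Iio x).subset Set.inter_subset_right)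
    ((Set.finite_Iio x).subset Set.inter_subset_right)]
  push_cast
  ring

theorem HasAsymptoticDensity.nonneg {A : Set ℕ} {a : ℝ} (hA : HasAsymptoticDensity A a) :
    0 ≤ a :=
  ge_of_tendsto' hA fun _ => by positivity

theorem HasAsymptoticDensity.le_one {A : Set ℕ} {a : ℝ} (hA : HasAsymptoticDensity A a) :
    a ≤ 1 := by
  refine le_of_tendsto_of_tendsto' hA hasAsymptoticDensity_univ fun x => ?_
  gcongr
  · exact (Set.finite_Iio x).subset Set.inter_subset_right
  · exact Set.subset_univ A

theorem HasAsymptoticDensity.two_mul_add {A : Set ℕ} {a : ℝ} (hA : HasAsymptoticDensity A a)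
    {e : ℕ} (he : e < 2) : HasAsymptoticDensity {n | n % 2 = e ∧ n / 2 ∈ A} (a / 2) := by
  -- `2 * m + e < x` holds exactly when `m < y x`.
  set y : ℕ → ℕ := fun x => (x + (1 - e)) / 2 with hy
  have hcard : ∀ x, ({n | n % 2 = e ∧ n / 2 ∈ A} ∩ Set.Iio x).ncard =
      (A ∩ Set.Iio (y x)).ncard := by
    intro x
    rw [← Set.ncard_image_of_injective (f := fun m => 2 * m + e) (A ∩ Set.Iio (y x))
      (fun m n h => by simpa using h)]
    congr 1
    ext n
    simp only [Set.mem_inter_iff, Set.mem_ofPred_eq, Set.mem_Iio, Set.mem_image, hy]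
    constructor
    · rintro ⟨⟨h1, h2⟩, h3⟩
      exact ⟨n / 2, ⟨h2, by omega⟩, by omega⟩
    · rintro ⟨m, ⟨h1, h2⟩, rfl⟩
      refine ⟨⟨by omega, ?_⟩, by omega⟩
      rwa [show (2 * m + e) / 2 = m by omega]
  have hytop : Tendsto y atTop atTop := by
    refine tendsto_atTop_atTop.2 fun b => ⟨2 * b, fun x hx => ?_⟩
    simp only [hy]
    omega
  have hratio : Tendsto (fun x : ℕ => (y x : ℝ) / x) atTop (𝓝 (1 / 2)) := by
    have h1 : Tendsto (fun x : ℕ => 1 / 2 - (1 : ℝ) / x) atTop (𝓝 (1 / 2)) := by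
      simpa using tendsto_const_nhds.sub (tendsto_one_div_atTop_nhds_zero_nat (𝕜 := ℝ))
    have h2 : Tendsto (fun x : ℕ => 1 / 2 + (1 : ℝ) / x) atTop (𝓝 (1 / 2)) := by
      simpa using tendsto_const_nhds.add (tendsto_one_div_atTop_nhds_zero_nat (𝕜 := ℝ))
    refine tendsto_of_tendsto_of_tendsto_of_le_of_le' h1 h2 ?_ ?_ <;>
      filter_upwards [eventually_gt_atTop 0] with x hx
    · have : (x : ℝ) ≤ 2 * y x + 2 := by
        simp only [hy]
        exact_mod_cast (by omega : x ≤ 2 * ((x + (1 - e)) / 2) + 2)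
      have hx' : (0 : ℝ) < x := by exact_mod_cast hx
      rw [div_sub_div _ _ two_ne_zero hx'.ne', div_le_div_iff₀ (by positivity) hx']
      nlinarith
    · have : 2 * (y x : ℝ) ≤ x + 2 := by
        simp only [hy]
        exact_mod_cast (by omega : 2 * ((x + (1 - e)) / 2) ≤ x + 2)
      have hx' : (0 : ℝ) < x := by exact_mod_cast hx
      rw [div_add_div _ _ two_ne_zero hx'.ne', div_le_div_iff₀ hx' (by positivity)]
      nlinarith
  have := (Tendsto.comp hA hytop).mul hratio
  rw [mul_one_div] at this
  refine this.congr' ?_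
  filter_upwards [hytop.eventually (eventually_gt_atTop 0)] with x hx
  have hx' : (y x : ℝ) ≠ 0 := by exact_mod_cast hx.ne'
  simp only [Function.comp, hcard]
  field_simp

/-! ### The densities of the level sets, separated by parity -/

/-- The set of `n` of parity `e` with `d(T, n) = k`. -/
def levelSet (T e : ℕ) (k : ℤ) : Set ℕ := {n | n % 2 = e ∧ blockDiff T n = k}

theorem levelSet_disjoint (T T' : ℕ) (k k' : ℤ) :
    Disjoint (levelSet T 0 k) (levelSet T' 1 k') := by
  refine Set.disjoint_left.2 fun n h h' => ?_
  have := h.1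
  have := h'.1
  omega

theorem levelSet_eq (T : ℕ) {e : ℕ} (he : e < 2) (k : ℤ) :
    levelSet T e k = {n | n % 2 = e ∧ n / 2 ∈ levelSet ((T + e) / 2) 0 (k - digitGain T e 0) ∪
      levelSet ((T + e) / 2) 1 (k - digitGain T e 1)} := by
  ext n
  simp only [levelSet, Set.mem_ofPred_eq, Set.mem_union]
  refine and_congr_right fun hn => ?_
  have h : n = 2 * (n / 2) + e := by omega
  have h' := blockDiff_two_mul_add T (n / 2) e he
  rw [← h] at h'
  rw [h']
  rcases Nat.mod_two_eq_zero_or_one (n / 2) with hm | hm <;> rw [hm] <;> simp [eq_sub_iff_add_eq]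

theorem HasAsymptoticDensity.levelSet {T e : ℕ} (he : e < 2) {k : ℤ} {a b : ℝ}
    (ha : HasAsymptoticDensity (levelSet ((T + e) / 2) 0 (k - digitGain T e 0)) a)
    (hb : HasAsymptoticDensity (_root_.levelSet ((T + e) / 2) 1 (k - digitGain T e 1)) b) :
    HasAsymptoticDensity (_root_.levelSet T e k) ((a + b) / 2) := by
  rw [levelSet_eq T he]
  exact (ha.union hb (levelSet_disjoint _ _ _ _)).two_mul_add he

theorem hasAsymptoticDensity_levelSet_zero {e : ℕ} (he : e < 2) (k : ℤ) :
    HasAsymptoticDensity (levelSet 0 e k) (if k = 0 then 1 / 2 else 0) := by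
  split_ifs with hk
  · convert hasAsymptoticDensity_univ.two_mul_add he using 1
    ext n
    simp [levelSet, blockDiff_zero, hk]
  · convert hasAsymptoticDensity_empty using 1
    ext n
    simp [levelSet, blockDiff_zero, Ne.symm hk]

theorem exists_hasAsymptoticDensity_levelSet (T : ℕ) :
    ∀ {e : ℕ}, e < 2 → ∀ k, ∃ c, HasAsymptoticDensity (levelSet T e k) c := by
  induction T using Nat.strong_induction_on with
  | _ T ih =>
    have step : ∀ {e : ℕ}, e < 2 → (T + e) / 2 < T → ∀ k,
        ∃ c, HasAsymptoticDensity (levelSet T e k) c := by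
      intro e he hlt k
      obtain ⟨a, ha⟩ := ih _ hlt (e := 0) (by omega) (k - digitGain T e 0)
      obtain ⟨b, hb⟩ := ih _ hlt (e := 1) (by omega) (k - digitGain T e 1)
      exact ⟨_, ha.levelSet he hb⟩
    intro e he k
    rcases Nat.eq_zero_or_pos T with rfl | hT
    · exact ⟨_, hasAsymptoticDensity_levelSet_zero he k⟩
    by_cases hlt : (T + e) / 2 < T
    · exact step he hlt k
    -- The only positive shift that fails to decrease: `(1 + 1) / 2 = 1`. Here level `k` depends on
    -- level `k + 1` of the same family, and high levels are empty, so induction runs downward in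
    -- `k`.
    obtain ⟨rfl, rfl⟩ : T = 1 ∧ e = 1 := by omega
    have key : ∀ j : ℕ, ∀ k : ℤ, k = 2 - j → ∃ c, HasAsymptoticDensity (levelSet 1 1 k) c := by
      intro j
      induction j with
      | zero =>
        rintro k rfl
        refine ⟨0, ?_⟩
        convert hasAsymptoticDensity_empty using 1
        refine Set.eq_empty_iff_forall_notMem.2 fun n hn => ?_
        have := blockDiff_one_le n
        have := hn.2
        push_cast at *
        omega
      | succ j ihj =>
        rintro k rfl
        obtain ⟨a, ha⟩ := step (e := 0) (by omega) (by omega)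
          (2 - ((j + 1 : ℕ) : ℤ) - digitGain 1 1 0)
        obtain ⟨b, hb⟩ := ihj (2 - ((j + 1 : ℕ) : ℤ) - digitGain 1 1 1)
          (by simp [digitGain]; ring)
        exact ⟨_, HasAsymptoticDensity.levelSet (by omega) ha hb⟩
    by_cases hk : k ≤ 2
    · exact key (2 - k).toNat k (by omega)
    · refine ⟨0, ?_⟩
      convert hasAsymptoticDensity_empty using 1
      refine Set.eq_empty_iff_forall_notMem.2 fun n hn => ?_
      have := blockDiff_one_le n
      have := hn.2
      omega

open Classical in
/-- The density of `levelSet T e k`. -/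
noncomputable def levelDensity (T e : ℕ) (k : ℤ) : ℝ :=
  if h : ∃ c, HasAsymptoticDensity (levelSet T e k) c then h.choose else 0

theorem hasAsymptoticDensity_levelSet (T : ℕ) {e : ℕ} (he : e < 2) (k : ℤ) :
    HasAsymptoticDensity (levelSet T e k) (levelDensity T e k) := by
  have h := exists_hasAsymptoticDensity_levelSet T he k
  rw [levelDensity, dif_pos h]
  exact h.choose_spec

theorem levelDensity_eq (T : ℕ) {e : ℕ} (he : e < 2) (k : ℤ) :
    levelDensity T e k = (levelDensity ((T + e) / 2) 0 (k - digitGain T e 0) +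
      levelDensity ((T + e) / 2) 1 (k - digitGain T e 1)) / 2 :=
  (hasAsymptoticDensity_levelSet T he k).unique
    (.levelSet he (hasAsymptoticDensity_levelSet _ two_pos _)
      (hasAsymptoticDensity_levelSet _ one_lt_two _))

theorem levelDensity_zero {e : ℕ} (he : e < 2) (k : ℤ) :
    levelDensity 0 e k = if k = 0 then 1 / 2 else 0 :=
  (hasAsymptoticDensity_levelSet 0 he k).unique (hasAsymptoticDensity_levelSet_zero he k)

theorem hasAsymptoticDensity_blockDiff (t : ℕ) (k : ℤ) :
    HasAsymptoticDensity {n | blockDiff t n = k} (levelDensity t 0 k + levelDensity t 1 k) := by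
  convert (hasAsymptoticDensity_levelSet t two_pos k).union
    (hasAsymptoticDensity_levelSet t one_lt_two k) (levelSet_disjoint _ _ _ _) using 1
  ext n
  rcases Nat.mod_two_eq_zero_or_one n with hn | hn <;> simp [levelSet, hn]

theorem levelDensity_nonneg (T : ℕ) {e : ℕ} (he : e < 2) (k : ℤ) : 0 ≤ levelDensity T e k :=
  (hasAsymptoticDensity_levelSet T he k).nonneg

/-- Density is finitely additive, so every finite partial sum is the density of a set and is at most
`1`. Total mass is not needed. -/
theorem summable_levelDensity (T : ℕ) {e : ℕ} (he : e < 2) : Summable (levelDensity T e) := by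
  refine summable_of_sum_le (c := 1) (levelDensity_nonneg T he) fun s => ?_
  have key : HasAsymptoticDensity (⋃ k ∈ s, levelSet T e k) (∑ k ∈ s, levelDensity T e k) := by
    induction s using Finset.induction_on with
    | empty => simpa using hasAsymptoticDensity_empty
    | insert k s hk ih =>
      rw [Finset.sum_insert hk, Finset.set_biUnion_insert]
      refine (hasAsymptoticDensity_levelSet T he k).union ih ?_
      refine Set.disjoint_iUnion₂_right.2 fun j hj => Set.disjoint_left.2 fun n hn hn' => ?_
      exact hk (by rwa [← hn.2, hn'.2])
  exact key.le_one

/-! ### Characteristic functions -/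

/-- The characteristic function of `d(T, n)`, where `n` is random of parity `e`. -/
noncomputable def condChar (T e : ℕ) (θ : ℝ) : ℂ :=
  2 * ∑' k : ℤ, (levelDensity T e k : ℂ) * Complex.exp (k * θ * Complex.I)

theorem norm_exp_ofReal_mul_ofReal_mul_I (x y : ℝ) : ‖Complex.exp (x * y * Complex.I)‖ = 1 := by
  rw [← Complex.ofReal_mul, Complex.norm_exp_ofReal_mul_I]

theorem norm_exp_intCast_mul_ofReal_mul_I (k : ℤ) (y : ℝ) :
    ‖Complex.exp (k * y * Complex.I)‖ = 1 := by
  simpa using norm_exp_ofReal_mul_ofReal_mul_I k y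

theorem summable_condChar (T : ℕ) {e : ℕ} (he : e < 2) (θ : ℝ) :
    Summable fun k : ℤ => (levelDensity T e k : ℂ) * Complex.exp (k * θ * Complex.I) := by
  refine Summable.of_norm ?_
  simpa [norm_exp_intCast_mul_ofReal_mul_I] using (summable_levelDensity T he).abs

theorem tsum_levelDensity_shift (T : ℕ) (e : ℕ) (g : ℤ) (θ : ℝ) :
    2 * ∑' k : ℤ, (levelDensity T e (k - g) : ℂ) * Complex.exp (k * θ * Complex.I) =
      Complex.exp (g * θ * Complex.I) * condChar T e θ := by
  rw [condChar, mul_left_comm (Complex.exp _)]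
  congr 1
  rw [← (Equiv.addRight g).tsum_eq, ← tsum_mul_left]
  refine tsum_congr fun k => ?_
  simp only [Equiv.coe_addRight, add_sub_cancel_right]
  rw [mul_left_comm, ← Complex.exp_add]
  push_cast
  ring_nf

theorem condChar_eq (T : ℕ) {e : ℕ} (he : e < 2) (θ : ℝ) :
    condChar T e θ =
      (Complex.exp (digitGain T e 0 * θ * Complex.I) * condChar ((T + e) / 2) 0 θ +
        Complex.exp (digitGain T e 1 * θ * Complex.I) * condChar ((T + e) / 2) 1 θ) / 2 := by
  have hs : ∀ μ < 2, ∀ g : ℤ, Summable fun k : ℤ =>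
      (levelDensity ((T + e) / 2) μ (k - g) : ℂ) * Complex.exp (k * θ * Complex.I) := by
    intro μ hμ g
    refine Summable.of_norm ?_
    have := (Equiv.subRight g).summable_iff.2 (summable_levelDensity ((T + e) / 2) hμ)
    simpa [norm_exp_intCast_mul_ofReal_mul_I] using this.abs
  rw [← tsum_levelDensity_shift, ← tsum_levelDensity_shift, ← mul_add,
    ← (hs 0 two_pos _).tsum_add (hs 1 one_lt_two _), condChar, mul_div_assoc, ← tsum_div_const]
  congr 1
  refine tsum_congr fun k => ?_
  rw [levelDensity_eq T he]
  push_cast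
  ring

theorem condChar_zero {e : ℕ} (he : e < 2) (θ : ℝ) : condChar 0 e θ = 1 := by
  rw [condChar, tsum_eq_single 0 (fun k hk => by simp [levelDensity_zero he, hk])]
  simp [levelDensity_zero he]

theorem norm_condChar_le (T : ℕ) {e : ℕ} (he : e < 2) (θ : ℝ) :
    ‖condChar T e θ‖ ≤
      (‖condChar ((T + e) / 2) 0 θ‖ + ‖condChar ((T + e) / 2) 1 θ‖) / 2 := by
  rw [condChar_eq T he, norm_div, Complex.norm_ofNat]
  gcongr
  refine (norm_add_le _ _).trans ?_
  simp [norm_exp_intCast_mul_ofReal_mul_I]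

/-! ### The upper bound -/

theorem countZeroOne_zero : countZeroOne 0 = 0 := by
  simp [countZeroOne]

theorem countZeroOne_le_half (t : ℕ) : countZeroOne t ≤ countZeroOne (t / 2) + 1 := by
  have h := countZeroOne_two_mul_add (t / 2) (t % 2) (Nat.mod_lt _ two_pos)
  rw [Nat.div_add_mod] at h
  have : t % 2 * (1 - t / 2 % 2) ≤ 1 * 1 := Nat.mul_le_mul (by omega) (by omega)
  omega

theorem countZeroOne_half {t : ℕ} (ht : t % 4 ≠ 1) : countZeroOne t = countZeroOne (t / 2) := by
  have h := countZeroOne_two_mul_add (t / 2) (t % 2) (Nat.mod_lt _ two_pos)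
  rw [Nat.div_add_mod] at h
  have : t % 2 = 0 ∨ 1 - t / 2 % 2 = 0 := by omega
  rcases this with h' | h' <;> simpa [h'] using h

/-- The accumulated phase over four digits. -/
def fourGain (T e a b c d : ℕ) : ℤ :=
  digitGain T e a + digitGain ((T + e) / 2) a b + digitGain (((T + e) / 2 + a) / 2) b c +
    digitGain ((((T + e) / 2 + a) / 2 + b) / 2) c d

theorem condChar_eq_four (T : ℕ) {e : ℕ} (he : e < 2) (θ : ℝ) :
    condChar T e θ = (∑ p : Fin 2 × Fin 2 × Fin 2 × Fin 2,
      Complex.exp (fourGain T e p.1 p.2.1 p.2.2.1 p.2.2.2 * θ * Complex.I) *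
        condChar (((((T + e) / 2 + p.1) / 2 + p.2.1) / 2 + p.2.2.1) / 2) p.2.2.2 θ) / 16 := by
  simp only [Fintype.sum_prod_type, Fin.sum_univ_two, fourGain, Int.cast_add, add_mul,
    Complex.exp_add, Fin.val_zero, Fin.val_one]
  rw [condChar_eq T he, condChar_eq ((T + e) / 2) two_pos, condChar_eq ((T + e) / 2) one_lt_two]
  simp only [condChar_eq (((T + e) / 2 + _) / 2) two_pos,
    condChar_eq (((T + e) / 2 + _) / 2) one_lt_two,
    condChar_eq ((((T + e) / 2 + _) / 2 + _) / 2) two_pos,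
    condChar_eq ((((T + e) / 2 + _) / 2 + _) / 2) one_lt_two]
  ring

theorem digitGain_congr {T T' : ℕ} (h : T % 4 = T' % 4) (e μ : ℕ) :
    digitGain T e μ = digitGain T' e μ := by
  rw [digitGain, digitGain, show (T + e) % 2 = (T' + e) % 2 by omega,
    show (μ + (T + e) / 2) % 2 = (μ + (T' + e) / 2) % 2 by omega]

/-- The source of cancellation: two digit paths merge again with phases differing by exactly `θ`.
Residues mod 32 suffice because the last gain sees the shift mod 4 after three halvings. -/
theorem exists_fourGain_pair_aux : ∀ r : Fin 32, (r : ℕ) % 4 = 1 → ∀ c e : Fin 2,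
    ∃ p q : Fin 2 × Fin 2 × Fin 2 × Fin 2, p ≠ q ∧ p.2.2.2 = q.2.2.2 ∧
      (((((r : ℕ) + c + e) / 2 + p.1) / 2 + p.2.1) / 2 + p.2.2.1) / 2 =
        (((((r : ℕ) + c + e) / 2 + q.1) / 2 + q.2.1) / 2 + q.2.2.1) / 2 ∧
      fourGain ((r : ℕ) + c) e p.1 p.2.1 p.2.2.1 p.2.2.2 =
        fourGain ((r : ℕ) + c) e q.1 q.2.1 q.2.2.1 q.2.2.2 + 1 := by
  decide +kernel

theorem exists_fourGain_pair {t : ℕ} (ht : t % 4 = 1) {c e : ℕ} (hc : c < 2) (he : e < 2) :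
    ∃ p q : Fin 2 × Fin 2 × Fin 2 × Fin 2, p ≠ q ∧ p.2.2.2 = q.2.2.2 ∧
      ((((t + c + e) / 2 + p.1) / 2 + p.2.1) / 2 + p.2.2.1) / 2 =
        ((((t + c + e) / 2 + q.1) / 2 + q.2.1) / 2 + q.2.2.1) / 2 ∧
      fourGain (t + c) e p.1 p.2.1 p.2.2.1 p.2.2.2 =
        fourGain (t + c) e q.1 q.2.1 q.2.2.1 q.2.2.2 + 1 := by
  have key : ∀ p : Fin 2 × Fin 2 × Fin 2 × Fin 2,
      fourGain (t + c) e p.1 p.2.1 p.2.2.1 p.2.2.2 =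
        fourGain (t % 32 + c) e p.1 p.2.1 p.2.2.1 p.2.2.2 := by
    intro p
    rw [fourGain, fourGain]
    congr 1
    · congr 1
      · congr 1
        · exact digitGain_congr (by omega) _ _
        · exact digitGain_congr (by omega) _ _
      · exact digitGain_congr (by omega) _ _
    · exact digitGain_congr (by omega) _ _
  obtain ⟨p, q, hpq, h1, h2, h3⟩ :=
    exists_fourGain_pair_aux ⟨t % 32, Nat.mod_lt _ (by norm_num)⟩ (by simp only; omega) ⟨c, hc⟩
      ⟨e, he⟩
  simp only at h2 h3
  refine ⟨p, q, hpq, h1, by omega, ?_⟩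
  rw [key, key, h3]

theorem norm_exp_mul_I_add_one (θ : ℝ) :
    ‖Complex.exp (θ * Complex.I) + 1‖ = 2 * |Real.cos (θ / 2)| := by
  have h : Complex.exp (θ * Complex.I) + 1 =
      Complex.exp ((θ / 2 : ℝ) * Complex.I) * ((2 * Real.cos (θ / 2) : ℝ) : ℂ) := by
    push_cast
    rw [Complex.two_cos, mul_add, ← Complex.exp_add, ← Complex.exp_add]
    ring_nf
    rw [Complex.exp_zero, add_comm]
  rw [h, norm_mul, Complex.norm_exp_ofReal_mul_I, one_mul, Complex.norm_real, Real.norm_eq_abs,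
    abs_mul, abs_two]

/-- Of the sixteen summands, fourteen are bounded trivially, and the merging pair contributes the
factor `‖exp (iθ) + 1‖ = 2 |cos (θ / 2)|`. -/
theorem norm_condChar_le_of_mod_four {t : ℕ} (ht : t % 4 = 1) {θ M : ℝ}
    (hM : ∀ c < 2, ∀ e < 2, ‖condChar (t / 16 + c) e θ‖ ≤ M) {c e : ℕ} (hc : c < 2) (he : e < 2) :
    ‖condChar (t + c) e θ‖ ≤ (14 + 2 * |Real.cos (θ / 2)|) / 16 * M := by
  obtain ⟨p, q, hpq, h1, h2, h3⟩ := exists_fourGain_pair ht hc he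
  have hM' : ∀ r : Fin 2 × Fin 2 × Fin 2 × Fin 2,
      ‖condChar (((((t + c + e) / 2 + r.1) / 2 + r.2.1) / 2 + r.2.2.1) / 2) r.2.2.2 θ‖ ≤ M := by
    intro r
    have := hM ((((((t + c + e) / 2 + r.1) / 2 + r.2.1) / 2 + r.2.2.1) / 2) - t / 16) (by omega)
      r.2.2.2 (by omega)
    rwa [Nat.add_sub_cancel' (by omega)] at this
  rw [condChar_eq_four _ he, norm_div, div_mul_eq_mul_div, Complex.norm_ofNat]
  gcongr
  have hq : q ∈ Finset.univ.erase p := Finset.mem_erase.2 ⟨hpq.symm, Finset.mem_univ _⟩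
  rw [← Finset.add_sum_erase _ _ (Finset.mem_univ p), ← Finset.add_sum_erase _ _ hq, ← add_assoc]
  refine (norm_add_le _ _).trans ?_
  rw [add_comm, add_mul]
  refine add_le_add ?_ ?_
  · refine (norm_sum_le_of_le (f := _) (n := fun _ => M) _ fun r _ => ?_).trans ?_
    · rw [norm_mul, norm_exp_intCast_mul_ofReal_mul_I, one_mul]
      exact hM' r
    · rw [Finset.sum_const, Finset.card_erase_of_mem hq,
        Finset.card_erase_of_mem (Finset.mem_univ p)]
      simp
  · rw [h3, h1, h2, ← add_mul, norm_mul]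
    have : Complex.exp (((fourGain (t + c) e q.1 q.2.1 q.2.2.1 q.2.2.2 + 1 : ℤ) : ℂ) * θ *
          Complex.I) +
        Complex.exp (fourGain (t + c) e q.1 q.2.1 q.2.2.1 q.2.2.2 * θ * Complex.I) =
        Complex.exp (fourGain (t + c) e q.1 q.2.1 q.2.2.1 q.2.2.2 * θ * Complex.I) *
          (Complex.exp (θ * Complex.I) + 1) := by
      rw [mul_add, ← Complex.exp_add, mul_one]
      push_cast
      ring_nf
    rw [this, norm_mul, norm_exp_intCast_mul_ofReal_mul_I, one_mul, norm_exp_mul_I_add_one]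
    gcongr
    exact hM' q

theorem gain_le_exp {θ : ℝ} (hθ : |θ| ≤ Real.pi) :
    (14 + 2 * |Real.cos (θ / 2)|) / 16 ≤ Real.exp (-(θ ^ 2 / 1000) * 4) := by
  have hθ' := abs_le.1 hθ
  have hcos : 0 ≤ Real.cos (θ / 2) :=
    Real.cos_nonneg_of_mem_Icc ⟨by linarith [Real.pi_pos], by linarith [Real.pi_pos]⟩
  have h2 : Real.cos (θ / 2) ≤ 1 - 2 / Real.pi ^ 2 * (θ / 2) ^ 2 :=
    Real.cos_le_one_sub_mul_cos_sq (by rw [abs_div, abs_two]; linarith [Real.pi_pos])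
  have hpi : Real.pi ^ 2 ≤ 10 := by nlinarith [Real.pi_lt_d2, Real.pi_pos]
  have h3 : 1 / 5 ≤ 2 / Real.pi ^ 2 := by
    rw [div_le_div_iff₀ (by norm_num) (by positivity)]
    linarith
  rw [abs_of_nonneg hcos]
  refine le_trans ?_ (Real.add_one_le_exp _)
  nlinarith [sq_nonneg θ]

/-- The pair `t, t + 1` is carried along because halving with a carry sends it into `t / 2, t / 2 +
1`. If `t % 4 = 1`, four digits are removed at once: at most four blocks disappear, and the
cancellation pays for four. Otherwise one digit is removed and no block is lost. -/
theorem norm_condChar_add_le {θ : ℝ} (hθ : |θ| ≤ Real.pi) (t : ℕ) :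
    ∀ c < 2, ∀ e < 2, ‖condChar (t + c) e θ‖ ≤ Real.exp (-(θ ^ 2 / 1000) * countZeroOne t) := by
  induction t using Nat.strong_induction_on with
  | _ t ih =>
    intro c hc e he
    rcases Nat.eq_zero_or_pos t with rfl | ht
    · have h0 : ∀ e < 2, ‖condChar 0 e θ‖ ≤ 1 := fun e he => by simp [condChar_zero he]
      have h10 : ‖condChar 1 0 θ‖ ≤ 1 := by
        have := norm_condChar_le 1 two_pos θ
        linarith [h0 0 two_pos, h0 1 one_lt_two]
      -- The recursion refers back to the same quantity with weight `1 / 2`, which can be absorbed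
      -- on the left.
      have h11 : ‖condChar 1 1 θ‖ ≤ 1 := by
        have : ‖condChar 1 1 θ‖ ≤ (‖condChar 1 0 θ‖ + ‖condChar 1 1 θ‖) / 2 :=
          norm_condChar_le 1 one_lt_two θ
        linarith
      rw [countZeroOne_zero, Nat.cast_zero, mul_zero, Real.exp_zero]
      interval_cases c
      · exact h0 e he
      · interval_cases e
        · exact h10
        · exact h11
    by_cases h4 : t % 4 = 1
    · refine (norm_condChar_le_of_mod_four h4 (ih (t / 16) (by omega)) hc he).trans ?_
      have hN : countZeroOne t ≤ countZeroOne (t / 16) + 4 := by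
        have e1 := countZeroOne_le_half t
        have e2 := countZeroOne_le_half (t / 2)
        have e3 := countZeroOne_le_half (t / 2 / 2)
        have e4 := countZeroOne_le_half (t / 2 / 2 / 2)
        rw [show t / 2 / 2 / 2 / 2 = t / 16 by omega] at e4
        omega
      have hN' : (countZeroOne t : ℝ) ≤ countZeroOne (t / 16) + 4 := by exact_mod_cast hN
      calc _ ≤ Real.exp (-(θ ^ 2 / 1000) * 4) *
            Real.exp (-(θ ^ 2 / 1000) * countZeroOne (t / 16)) := by
            gcongr
            exact gain_le_exp hθ
        _ = Real.exp (-(θ ^ 2 / 1000) * (countZeroOne (t / 16) + 4)) := by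
            rw [← Real.exp_add]
            ring_nf
        _ ≤ _ := by
            refine Real.exp_le_exp.2 ?_
            nlinarith [sq_nonneg θ]
    · have ih' : ∀ μ < 2, ‖condChar ((t + c + e) / 2) μ θ‖ ≤
          Real.exp (-(θ ^ 2 / 1000) * countZeroOne (t / 2)) := by
        intro μ hμ
        have := ih (t / 2) (by omega) ((t + c + e) / 2 - t / 2) (by omega) μ hμ
        rwa [Nat.add_sub_cancel' (by omega)] at this
      rw [countZeroOne_half h4]
      linarith [norm_condChar_le (t + c) he θ, ih' 0 two_pos, ih' 1 one_lt_two]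

/-! ### The variance sequence -/

/-- Keeps the two parity-conditional variances within `2` of each other (`abs_condVar_sub_le`), so
that the cost of one Gaussian step is uniform. -/
theorem abs_varianceSeq_succ_sub_le (t : ℕ) :
    |varianceSeq (t + 1) - varianceSeq t| ≤ 3 / 2 := by
  induction t using Nat.strong_induction_on with
  | _ t ih =>
    rcases Nat.eq_zero_or_pos t with rfl | ht
    · rw [zero_add, varianceSeq_one, varianceSeq_zero]
      norm_num
    obtain ⟨s, d, hd, rfl⟩ : ∃ s d, d < 4 ∧ t = 4 * s + d := ⟨t / 4, t % 4, by omega, by omega⟩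
    have e0 := varianceSeq_four_mul s
    have e1 := varianceSeq_two_mul_add_one (2 * s)
    have e2 := varianceSeq_four_mul_add_two s
    have e3 := varianceSeq_two_mul_add_one (2 * s + 1)
    have e4 := varianceSeq_four_mul (s + 1)
    rw [show 2 * (2 * s) + 1 = 4 * s + 1 by ring] at e1
    rw [show 2 * (2 * s + 1) + 1 = 4 * s + 3 by ring, show 2 * s + 1 + 1 = 2 * s + 2 by ring] at e3
    rw [show 4 * (s + 1) = 4 * s + 4 by ring, show 2 * (s + 1) = 2 * s + 2 by ring] at e4
    interval_cases d
    · have := abs_le.1 (ih (2 * s) (by omega))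
      rw [add_zero, e0, e1]
      exact abs_le.2 ⟨by linarith, by linarith⟩
    · have := abs_le.1 (ih (2 * s) (by omega))
      rw [show 4 * s + 1 + 1 = 4 * s + 2 by ring, e1, e2]
      exact abs_le.2 ⟨by linarith, by linarith⟩
    · have := abs_le.1 (ih (2 * s + 1) (by omega))
      rw [show 4 * s + 2 + 1 = 4 * s + 3 by ring, e2, e3]
      exact abs_le.2 ⟨by linarith, by linarith⟩
    · have := abs_le.1 (ih (2 * s + 1) (by omega))
      rw [show 4 * s + 3 + 1 = 4 * s + 4 by ring, e3, e4]
      exact abs_le.2 ⟨by linarith, by linarith⟩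

theorem varianceSeq_two_mul_of_even {t : ℕ} (ht : t % 2 = 0) :
    varianceSeq (2 * t) = varianceSeq t := by
  have := varianceSeq_four_mul (t / 2)
  rwa [show 4 * (t / 2) = 2 * t by omega, show 2 * (t / 2) = t by omega] at this

theorem varianceSeq_two_mul_of_odd {t : ℕ} (ht : t % 2 = 1) :
    varianceSeq (2 * t) = varianceSeq t + 1 := by
  have := varianceSeq_four_mul_add_two (t / 2)
  rwa [show 4 * (t / 2) + 2 = 2 * t by omega, show 2 * (t / 2) + 1 = t by omega] at this

theorem countZeroOne_two_mul (t : ℕ) : countZeroOne (2 * t) = countZeroOne t := by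
  simpa using countZeroOne_two_mul_add t 0 two_pos

theorem countZeroOne_two_mul_add_one_of_even {t : ℕ} (ht : t % 2 = 0) :
    countZeroOne (2 * t + 1) = countZeroOne t + 1 := by
  simpa [ht] using countZeroOne_two_mul_add t 1 one_lt_two

theorem countZeroOne_two_mul_add_one_of_odd {t : ℕ} (ht : t % 2 = 1) :
    countZeroOne (2 * t + 1) = countZeroOne t := by
  simpa [ht] using countZeroOne_two_mul_add t 1 one_lt_two

theorem countZeroOne_le_succ_of_even {t : ℕ} (ht : t % 2 = 0) :
    countZeroOne t ≤ countZeroOne (t + 1) := by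
  obtain ⟨s, rfl⟩ : ∃ s, t = 2 * s := ⟨t / 2, by omega⟩
  rw [countZeroOne_two_mul]
  rcases Nat.mod_two_eq_zero_or_one s with hs | hs
  · rw [countZeroOne_two_mul_add_one_of_even hs]
    omega
  · rw [countZeroOne_two_mul_add_one_of_odd hs]

theorem countZeroOne_le_succ_add_one (t : ℕ) : countZeroOne t ≤ countZeroOne (t + 1) + 1 := by
  induction t using Nat.strong_induction_on with
  | _ t ih =>
    rcases Nat.mod_two_eq_zero_or_one t with ht | ht
    · exact (countZeroOne_le_succ_of_even ht).trans (Nat.le_succ _)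
    · obtain ⟨s, rfl⟩ : ∃ s, t = 2 * s + 1 := ⟨t / 2, by omega⟩
      rw [show 2 * s + 1 + 1 = 2 * (s + 1) by ring, countZeroOne_two_mul]
      rcases Nat.mod_two_eq_zero_or_one s with hs | hs
      · rw [countZeroOne_two_mul_add_one_of_even hs]
        have := countZeroOne_le_succ_of_even hs
        omega
      · rw [countZeroOne_two_mul_add_one_of_odd hs]
        exact ih s (by omega)

/-- An odd step adds `3 / 4` to the variance, which pays either for a new block or for the averaged
loss when `s + 1` has one block fewer than `s`. -/
theorem countZeroOne_le_varianceSeq (t : ℕ) : 3 / 4 * (countZeroOne t : ℝ) ≤ varianceSeq t := by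
  induction t using Nat.strong_induction_on with
  | _ t ih =>
    rcases Nat.eq_zero_or_pos t with rfl | ht
    · simp [countZeroOne_zero, varianceSeq_zero]
    rcases Nat.eq_or_lt_of_le ht with rfl | ht1
    · have := countZeroOne_le_half 1
      have h : (countZeroOne 1 : ℝ) ≤ 1 := by
        simpa [countZeroOne_zero] using this
      rw [Nat.succ_eq_add_one, zero_add, varianceSeq_one]
      linarith
    rcases Nat.even_or_odd' t with ⟨s, rfl | rfl⟩
    · rw [countZeroOne_two_mul]
      have := ih s (by omega)
      rcases Nat.mod_two_eq_zero_or_one s with hs | hs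
      · rwa [varianceSeq_two_mul_of_even hs]
      · rw [varianceSeq_two_mul_of_odd hs]
        linarith
    · have h1 := ih s (by omega)
      have h2 := ih (s + 1) (by omega)
      rw [varianceSeq_two_mul_add_one]
      rcases Nat.mod_two_eq_zero_or_one s with hs | hs
      · rw [countZeroOne_two_mul_add_one_of_even hs]
        have : (countZeroOne s : ℝ) ≤ countZeroOne (s + 1) := by
          exact_mod_cast countZeroOne_le_succ_of_even hs
        push_cast
        linarith
      · rw [countZeroOne_two_mul_add_one_of_odd hs]
        have : (countZeroOne s : ℝ) ≤ countZeroOne (s + 1) + 1 := by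
          exact_mod_cast countZeroOne_le_succ_add_one s
        linarith

theorem varianceSeq_nonneg (t : ℕ) : 0 ≤ varianceSeq t :=
  le_trans (by positivity) (countZeroOne_le_varianceSeq t)

/-- Simultaneous bounds for `v_t` and `v_{t+1}`, depending on the parity of `t`. -/
theorem varianceSeq_le_aux (t : ℕ) :
    (t % 2 = 0 → varianceSeq t ≤ 5 * countZeroOne t + 5 / 2 ∧
      varianceSeq (t + 1) ≤ 5 * countZeroOne t + 4) ∧
    (t % 2 = 1 → varianceSeq t ≤ 5 * countZeroOne t + 3 / 2 ∧
      varianceSeq (t + 1) ≤ 5 * countZeroOne t) := by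
  induction t using Nat.strong_induction_on with
  | _ t ih =>
    rcases Nat.eq_zero_or_pos t with rfl | ht
    · simp [countZeroOne_zero, varianceSeq_zero, varianceSeq_one]
      norm_num
    rcases Nat.even_or_odd' t with ⟨s, rfl | rfl⟩
    · refine ⟨fun _ => ?_, fun h => by omega⟩
      rw [countZeroOne_two_mul, varianceSeq_two_mul_add_one]
      rcases Nat.mod_two_eq_zero_or_one s with hs | hs
      · obtain ⟨h1, h2⟩ := (ih s (by omega)).1 hs
        rw [varianceSeq_two_mul_of_even hs]
        exact ⟨h1, by linarith⟩
      · obtain ⟨h1, h2⟩ := (ih s (by omega)).2 hs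
        rw [varianceSeq_two_mul_of_odd hs]
        exact ⟨by linarith, by linarith⟩
    · refine ⟨fun h => by omega, fun _ => ?_⟩
      rw [varianceSeq_two_mul_add_one, show 2 * s + 1 + 1 = 2 * (s + 1) by ring]
      rcases Nat.mod_two_eq_zero_or_one s with hs | hs
      · obtain ⟨h1, h2⟩ := (ih s (by omega)).1 hs
        rw [varianceSeq_two_mul_of_odd (by omega), countZeroOne_two_mul_add_one_of_even hs]
        push_cast
        exact ⟨by linarith, by linarith⟩
      · obtain ⟨h1, h2⟩ := (ih s (by omega)).2 hs
        rw [varianceSeq_two_mul_of_even (by omega), countZeroOne_two_mul_add_one_of_odd hs]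
        exact ⟨by linarith, by linarith⟩

theorem varianceSeq_le (t : ℕ) : varianceSeq t ≤ 5 * countZeroOne t + 5 / 2 := by
  rcases Nat.mod_two_eq_zero_or_one t with ht | ht
  · exact ((varianceSeq_le_aux t).1 ht).1
  · linarith [((varianceSeq_le_aux t).2 ht).1]

/-! ### Means and variances given the parity -/

/-- The mean of `d(T, n)`, where `n` is random of parity `e`. -/
noncomputable def condMean (T e : ℕ) : ℝ := if T % 2 = 0 then 0 else 1 / 2 - e

/-- The variance of `d(T, n)`, where `n` is random of parity `e`. -/
noncomputable def condVar (T e : ℕ) : ℝ :=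
  varianceSeq ((T + e) / 2) +
    (if T % 2 = 0 then if (T + e) / 2 % 2 = 0 then (0 : ℝ) else 2 * (e : ℝ)
    else if (T + e) / 2 % 2 = 0 then (1 / 4 : ℝ) else 3 / 4)

/-- The characteristic function of `d(T, n)` minus its mean, where `n` is random of parity `e`. -/
noncomputable def centeredChar (T e : ℕ) (θ : ℝ) : ℂ :=
  Complex.exp (-(condMean T e * θ * Complex.I)) * condChar T e θ

/-- The centered contribution of the last digit `e` if the digit before it is `0`; it is the
negative of the one for the digit `1`. -/
noncomputable def centeredGain (T e : ℕ) : ℝ :=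
  digitGain T e 0 + condMean ((T + e) / 2) 0 - condMean T e

theorem centeredGain_eq {T e : ℕ} (he : e < 2) : centeredGain T e =
    if T % 2 = 0 then if (T + e) / 2 % 2 = 0 then 0 else 1 / 2 + (e : ℝ)
    else if (T + e) / 2 % 2 = 0 then (e : ℝ) - 1 / 2 else 1 := by
  have a0 : (0 + (T + e) / 2) % 2 = (T + e) / 2 % 2 := by omega
  have a1 : (T + e) % 2 = (T % 2 + e) % 2 := by omega
  rw [centeredGain, digitGain, condMean, condMean, a0, a1]
  rcases Nat.mod_two_eq_zero_or_one T with hT | hT <;>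
  rcases Nat.mod_two_eq_zero_or_one ((T + e) / 2) with h | h <;>
  rw [hT, h] <;> interval_cases e <;> norm_num

/-- The conditional mean is the average of the means of the two branches, so the deviations are
opposite. This symmetry removes the linear term in `θ`. -/
theorem centeredGain_neg {T e : ℕ} (he : e < 2) :
    digitGain T e 1 + condMean ((T + e) / 2) 1 - condMean T e = -centeredGain T e := by
  have a0 : (1 + (T + e) / 2) % 2 = 1 - (T + e) / 2 % 2 := by omega
  have a1 : (T + e) % 2 = (T % 2 + e) % 2 := by omega
  rw [centeredGain_eq he, digitGain, condMean, condMean, a0, a1]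
  rcases Nat.mod_two_eq_zero_or_one T with hT | hT <;>
  rcases Nat.mod_two_eq_zero_or_one ((T + e) / 2) with h | h <;>
  rw [hT, h] <;> interval_cases e <;> norm_num

theorem abs_centeredGain_le {T e : ℕ} (he : e < 2) : |centeredGain T e| ≤ 3 / 2 := by
  rw [centeredGain_eq he]
  interval_cases e <;> split_ifs <;> norm_num [abs_le]

/-- Law of total variance over the parity of `n`: for odd `T` the conditional means `±1 / 2`
contribute `1 / 4`. -/
theorem condVar_add (T : ℕ) :
    (condVar T 0 + condVar T 1) / 2 = varianceSeq T - (if T % 2 = 0 then (0 : ℝ) else 1 / 4) := by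
  rw [condVar, condVar]
  rcases Nat.even_or_odd' T with ⟨s, rfl | rfl⟩
  · have h : 2 * s % 2 = 0 := by omega
    rw [show (2 * s + 0) / 2 = s by omega, show (2 * s + 1) / 2 = s by omega, h]
    rcases Nat.mod_two_eq_zero_or_one s with hs | hs
    · simp [varianceSeq_two_mul_of_even hs, hs]
    · simp [varianceSeq_two_mul_of_odd hs, hs]
      ring
  · rw [show (2 * s + 1 + 0) / 2 = s by omega, show (2 * s + 1 + 1) / 2 = s + 1 by omega,
      varianceSeq_two_mul_add_one]
    split_ifs <;> first | omega | ring

/-- Law of total variance over the next digit, whose two values shift the mean by `±centeredGain T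
e`. -/
theorem condVar_eq (T : ℕ) {e : ℕ} (he : e < 2) : condVar T e =
    (condVar ((T + e) / 2) 0 + condVar ((T + e) / 2) 1) / 2 + centeredGain T e ^ 2 := by
  rw [condVar_add, condVar, centeredGain_eq he]
  interval_cases e <;> split_ifs <;> push_cast <;> ring

theorem condVar_nonneg (T : ℕ) (e : ℕ) : 0 ≤ condVar T e := by
  rw [condVar]
  refine add_nonneg (varianceSeq_nonneg _) ?_
  split_ifs <;> positivity

theorem abs_condVar_sub_le (T : ℕ) : |condVar T 0 - condVar T 1| ≤ 2 := by
  rw [condVar, condVar]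
  rcases Nat.mod_two_eq_zero_or_one T with hT | hT
  · rw [show (T + 1) / 2 = (T + 0) / 2 by omega, if_pos hT, if_pos hT]
    split_ifs <;> norm_num
  · rw [show (T + 1) / 2 = (T + 0) / 2 + 1 by omega]
    have := abs_le.1 (abs_varianceSeq_succ_sub_le ((T + 0) / 2))
    split_ifs <;> first | omega | exact abs_le.2 ⟨by linarith, by linarith⟩

theorem centeredChar_eq (T : ℕ) {e : ℕ} (he : e < 2) (θ : ℝ) : centeredChar T e θ =
    (Complex.exp (centeredGain T e * θ * Complex.I) * centeredChar ((T + e) / 2) 0 θ +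
      Complex.exp (-(centeredGain T e * θ * Complex.I)) * centeredChar ((T + e) / 2) 1 θ) / 2 := by
  have h0 : (centeredGain T e : ℂ) =
      digitGain T e 0 + condMean ((T + e) / 2) 0 - condMean T e := by
    rw [centeredGain]
    push_cast
    ring
  have h1 : (-centeredGain T e : ℂ) =
      digitGain T e 1 + condMean ((T + e) / 2) 1 - condMean T e := by
    rw [← Complex.ofReal_neg, ← centeredGain_neg he]
    push_cast
    ring
  rw [← neg_mul, ← neg_mul, h1, h0, centeredChar, centeredChar, centeredChar, condChar_eq T he,
    ← mul_assoc (Complex.exp _), ← mul_assoc (Complex.exp _), ← Complex.exp_add, ← Complex.exp_add,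
    mul_div_assoc', mul_add, ← mul_assoc, ← mul_assoc, ← Complex.exp_add, ← Complex.exp_add]
  ring_nf

/-! ### The Gaussian approximation near the origin -/

/-- Expand the first two exponentials to second order and the Gaussian to first order: the terms `±s
θ i` cancel and the `θ²` terms agree, leaving a cubic error. -/
theorem norm_exp_add_exp_sub_exp_le {γ s θ : ℝ} (hγ : |γ| ≤ 2) (hs : |s| ≤ 3 / 2) (hθ : |θ| ≤ 1) :
    ‖(Complex.exp (s * θ * Complex.I) +
        Complex.exp (-(s * θ * Complex.I) - (γ * θ ^ 2 / 2 : ℝ))) / 2 -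
      Complex.exp (-((γ / 2 + s ^ 2) * θ ^ 2 / 2 : ℝ))‖ ≤ 300 * |θ| ^ 3 := by
  set x : ℂ := s * θ * Complex.I with hx
  set y : ℂ := -(s * θ * Complex.I) - (γ * θ ^ 2 / 2 : ℝ) with hy
  set w : ℂ := -((γ / 2 + s ^ 2) * θ ^ 2 / 2 : ℝ) with hw
  have h0 : 0 ≤ |θ| := abs_nonneg θ
  have hθ2 : |θ| ^ 2 ≤ |θ| := by nlinarith
  have hs2 : s ^ 2 ≤ 9 / 4 := by
    rw [← sq_abs]
    nlinarith [abs_nonneg s]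
  have hxn : ‖x‖ ≤ 3 / 2 * |θ| := by
    rw [hx, norm_mul, norm_mul, Complex.norm_I, mul_one, Complex.norm_real, Complex.norm_real,
      Real.norm_eq_abs, Real.norm_eq_abs]
    gcongr
  have hyn : ‖y‖ ≤ 5 / 2 * |θ| := by
    refine (norm_sub_le _ _).trans ?_
    rw [norm_neg, Complex.norm_real, Real.norm_eq_abs, abs_div, abs_mul, abs_two, abs_pow]
    have : |γ| * |θ| ^ 2 ≤ 2 * |θ| := by gcongr
    rw [← hx]
    linarith
  have hwn : ‖w‖ ≤ 13 / 8 * |θ| ^ 2 := by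
    rw [hw, norm_neg, Complex.norm_real, Real.norm_eq_abs, abs_div, abs_mul, abs_two, abs_pow]
    have : |γ / 2 + s ^ 2| ≤ 13 / 4 := by
      have := abs_le.1 hγ
      exact abs_le.2 ⟨by nlinarith [sq_nonneg s], by linarith⟩
    nlinarith [sq_nonneg |θ|]
  have he : Real.exp (5 / 2) ≤ 21 := by
    have h1 : Real.exp (5 / 2) ≤ Real.exp 3 := Real.exp_le_exp.2 (by norm_num)
    have h2 : Real.exp 3 = Real.exp 1 ^ 3 := by rw [← Real.exp_nat_mul]; norm_num
    have h3 : Real.exp 1 ^ 3 ≤ 2.7182818286 ^ 3 := by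
      gcongr
      exact Real.exp_one_lt_d9.le
    norm_num at h3
    linarith
  have expb : ∀ {z : ℂ}, ‖z‖ ≤ 5 / 2 → Real.exp ‖z‖ ≤ 21 := fun hz =>
    (Real.exp_le_exp.2 hz).trans he
  have Ex := Complex.norm_exp_sub_sum_le_norm_mul_exp x 3
  have Ey := Complex.norm_exp_sub_sum_le_norm_mul_exp y 3
  have Ew := Complex.norm_exp_sub_sum_le_norm_mul_exp w 2
  simp only [Finset.sum_range_succ, Finset.sum_range_zero, pow_zero, pow_one, Nat.factorial]
    at Ex Ey Ew
  norm_num at Ex Ey Ew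
  have Ex' : ‖Complex.exp x - (1 + x + x ^ 2 / 2)‖ ≤ (3 / 2 * |θ|) ^ 3 * 21 :=
    Ex.trans (by gcongr; exact expb (by linarith))
  have Ey' : ‖Complex.exp y - (1 + y + y ^ 2 / 2)‖ ≤ (5 / 2 * |θ|) ^ 3 * 21 :=
    Ey.trans (by gcongr; exact expb (by linarith))
  have Ew' : ‖Complex.exp w - (1 + w)‖ ≤ (13 / 8 * |θ| ^ 2) ^ 2 * 21 :=
    Ew.trans (by gcongr; exact expb (by linarith))
  have main : (1 + x + x ^ 2 / 2 + (1 + y + y ^ 2 / 2)) / 2 - (1 + w) =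
      ((s * γ * θ ^ 3 / 4 : ℝ) : ℂ) * Complex.I + ((γ ^ 2 * θ ^ 4 / 16 : ℝ) : ℂ) := by
    rw [hx, hy, hw]
    push_cast
    linear_combination (s ^ 2 * θ ^ 2 / 2 : ℂ) * Complex.I_sq
  have hθ4 : |θ| ^ 4 ≤ |θ| ^ 3 := pow_le_pow_of_le_one h0 hθ (by norm_num)
  have main' : ‖(1 + x + x ^ 2 / 2 + (1 + y + y ^ 2 / 2)) / 2 - (1 + w)‖ ≤ |θ| ^ 3 := by
    rw [main]
    refine (norm_add_le _ _).trans ?_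
    rw [norm_mul, Complex.norm_I, mul_one, Complex.norm_real, Complex.norm_real, Real.norm_eq_abs,
      Real.norm_eq_abs, abs_div, abs_div, abs_mul, abs_mul, abs_mul, abs_pow, abs_pow, abs_pow]
    have h1 : |s| * |γ| * |θ| ^ 3 ≤ 3 / 2 * 2 * |θ| ^ 3 := by gcongr
    have h2 : |γ| ^ 2 * |θ| ^ 4 ≤ 2 ^ 2 * |θ| ^ 3 := by gcongr
    rw [abs_of_pos (by norm_num : (0 : ℝ) < 4), abs_of_pos (by norm_num : (0 : ℝ) < 16)]
    linarith
  have split : (Complex.exp x + Complex.exp y) / 2 - Complex.exp w =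
      (Complex.exp x - (1 + x + x ^ 2 / 2)) / 2 + (Complex.exp y - (1 + y + y ^ 2 / 2)) / 2 -
        (Complex.exp w - (1 + w)) +
        ((1 + x + x ^ 2 / 2 + (1 + y + y ^ 2 / 2)) / 2 - (1 + w)) := by ring
  rw [split]
  refine (norm_add_le _ _).trans ?_
  have t1 := norm_sub_le ((Complex.exp x - (1 + x + x ^ 2 / 2)) / 2 +
    (Complex.exp y - (1 + y + y ^ 2 / 2)) / 2) (Complex.exp w - (1 + w))
  have t2 := norm_add_le ((Complex.exp x - (1 + x + x ^ 2 / 2)) / 2)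
    ((Complex.exp y - (1 + y + y ^ 2 / 2)) / 2)
  rw [norm_div, norm_div, Complex.norm_ofNat] at t2
  have hpos : 0 ≤ |θ| ^ 3 := by positivity
  have e1 : (3 / 2 * |θ|) ^ 3 * 21 = 3 ^ 3 / 8 * 21 * |θ| ^ 3 := by ring
  have e2 : (5 / 2 * |θ|) ^ 3 * 21 = 5 ^ 3 / 8 * 21 * |θ| ^ 3 := by ring
  have e3 : (13 / 8 * |θ| ^ 2) ^ 2 * 21 = 13 ^ 2 / 64 * 21 * |θ| ^ 4 := by ring
  rw [e1] at Ex'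
  rw [e2] at Ey'
  rw [e3] at Ew'
  nlinarith

theorem norm_gaussian_avg_sub_le {α β s : ℝ} (hα : 0 ≤ α) (hβ : 0 ≤ β) (hαβ : |α - β| ≤ 2)
    (hs : |s| ≤ 3 / 2) (θ : ℝ) :
    ‖(Complex.exp (s * θ * Complex.I) * Real.exp (-(α * θ ^ 2 / 2)) +
        Complex.exp (-(s * θ * Complex.I)) * Real.exp (-(β * θ ^ 2 / 2))) / 2 -
      Real.exp (-(((α + β) / 2 + s ^ 2) * θ ^ 2 / 2))‖ ≤ 300 * |θ| ^ 3 := by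
  rcases le_or_gt |θ| 1 with hθ | hθ
  -- Factoring out `exp (-α θ² / 2) ≤ 1` leaves only the bounded difference `γ = β - α`, so the
  -- constant does not depend on the size of the variances.
  · have hγ : |β - α| ≤ 2 := by rwa [abs_sub_comm]
    have key := norm_exp_add_exp_sub_exp_le hγ hs hθ
    have heq : (Complex.exp (s * θ * Complex.I) * Real.exp (-(α * θ ^ 2 / 2)) +
        Complex.exp (-(s * θ * Complex.I)) * Real.exp (-(β * θ ^ 2 / 2))) / 2 -
        Real.exp (-(((α + β) / 2 + s ^ 2) * θ ^ 2 / 2)) =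
        Real.exp (-(α * θ ^ 2 / 2)) * ((Complex.exp (s * θ * Complex.I) +
          Complex.exp (-(s * θ * Complex.I) - ((β - α) * θ ^ 2 / 2 : ℝ))) / 2 -
        Complex.exp (-(((β - α) / 2 + s ^ 2) * θ ^ 2 / 2 : ℝ))) := by
      push_cast
      rw [mul_sub, mul_div_assoc', mul_add, ← Complex.exp_add, ← Complex.exp_add, ← Complex.exp_add,
        ← Complex.exp_add, ← Complex.exp_add]
      ring_nf
    rw [heq, norm_mul, Complex.norm_real, Real.norm_eq_abs, Real.abs_exp]
    have : Real.exp (-(α * θ ^ 2 / 2)) ≤ 1 := Real.exp_le_one_iff.2 (by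
      have : 0 ≤ α * θ ^ 2 / 2 := by positivity
      linarith)
    calc _ ≤ 1 * (300 * |θ| ^ 3) := by gcongr
      _ = _ := one_mul _
  · have hle : ∀ {v : ℝ}, 0 ≤ v → ‖(Real.exp (-(v * θ ^ 2 / 2)) : ℂ)‖ ≤ 1 := by
      intro v hv
      rw [Complex.norm_real, Real.norm_eq_abs, Real.abs_exp, Real.exp_le_one_iff]
      have : 0 ≤ v * θ ^ 2 / 2 := by positivity
      linarith
    have h1 : 1 ≤ |θ| ^ 3 := one_le_pow₀ hθ.le
    have hn : ‖Complex.exp (-(s * θ * Complex.I))‖ = 1 := by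
      have := norm_exp_ofReal_mul_ofReal_mul_I (-s) θ
      rwa [Complex.ofReal_neg, neg_mul, neg_mul] at this
    refine (norm_sub_le _ _).trans ?_
    have t := norm_add_le (Complex.exp (s * θ * Complex.I) * Real.exp (-(α * θ ^ 2 / 2)))
      (Complex.exp (-(s * θ * Complex.I)) * Real.exp (-(β * θ ^ 2 / 2)))
    rw [norm_mul, norm_mul, norm_exp_ofReal_mul_ofReal_mul_I, hn, one_mul, one_mul] at t
    rw [norm_div, Complex.norm_ofNat]
    have b1 := hle hα
    have b2 := hle hβ
    have b3 := hle (v := (α + β) / 2 + s ^ 2) (by positivity)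
    linarith

theorem norm_avg_sub_le {u u' p₀ p₁ g₀ g₁ g : ℂ} {r D : ℝ} (hu : ‖u‖ = 1) (hu' : ‖u'‖ = 1)
    (hr : ‖p₀ - g₀‖ + ‖p₁ - g₁‖ ≤ 2 * r) (hD : ‖(u * g₀ + u' * g₁) / 2 - g‖ ≤ D) :
    ‖(u * p₀ + u' * p₁) / 2 - g‖ ≤ r + D := by
  have key : (u * p₀ + u' * p₁) / 2 - g =
      (u * (p₀ - g₀) + u' * (p₁ - g₁)) / 2 + ((u * g₀ + u' * g₁) / 2 - g) := by
    ring
  rw [key]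
  refine (norm_add_le _ _).trans (add_le_add ?_ hD)
  rw [norm_div, Complex.norm_ofNat]
  have := norm_add_le (u * (p₀ - g₀)) (u' * (p₁ - g₁))
  rw [norm_mul, norm_mul, hu, hu', one_mul, one_mul] at this
  linarith

theorem norm_exp_neg_ofReal_mul_ofReal_mul_I (x y : ℝ) :
    ‖Complex.exp (-(x * y * Complex.I))‖ = 1 := by
  have := norm_exp_ofReal_mul_ofReal_mul_I (-x) y
  rwa [Complex.ofReal_neg, neg_mul, neg_mul] at this

theorem norm_centeredChar_sub_le_step (T : ℕ) {e : ℕ} (he : e < 2) {θ r D : ℝ}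
    (h0 : ‖centeredChar ((T + e) / 2) 0 θ -
      Real.exp (-(condVar ((T + e) / 2) 0 * θ ^ 2 / 2))‖ +
      ‖centeredChar ((T + e) / 2) 1 θ - Real.exp (-(condVar ((T + e) / 2) 1 * θ ^ 2 / 2))‖ ≤ 2 * r)
    (hD : ‖(Complex.exp (centeredGain T e * θ * Complex.I) *
          Real.exp (-(condVar ((T + e) / 2) 0 * θ ^ 2 / 2)) +
        Complex.exp (-(centeredGain T e * θ * Complex.I)) *
          Real.exp (-(condVar ((T + e) / 2) 1 * θ ^ 2 / 2))) / 2 -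
      Real.exp (-(condVar T e * θ ^ 2 / 2))‖ ≤ D) :
    ‖centeredChar T e θ - Real.exp (-(condVar T e * θ ^ 2 / 2))‖ ≤ r + D := by
  rw [centeredChar_eq T he]
  exact norm_avg_sub_le (norm_exp_ofReal_mul_ofReal_mul_I _ _)
    (norm_exp_neg_ofReal_mul_ofReal_mul_I _ _) h0 hD

/-- Each step costs at most `300 |θ|³`. When the centered gain is nonzero, its square is at least `1
/ 4`, so the bound grows by at least `600 |θ|³`: half pays for the step, and half may be saved. The
saving kept for `T % 4 = 2` pays for the one kind of step that has cost but no variance growth. -/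
theorem norm_centeredChar_sub_le (T : ℕ) : ∀ e < 2, ∀ θ : ℝ,
    ‖centeredChar T e θ - Real.exp (-(condVar T e * θ ^ 2 / 2))‖ ≤
      (2400 * condVar T e - if T % 4 = 2 then (300 : ℝ) else 0) * |θ| ^ 3 := by
  induction T using Nat.strong_induction_on with
  | _ T ih =>
    intro e he θ
    have hp : 0 ≤ |θ| ^ 3 := by positivity
    rcases Nat.eq_zero_or_pos T with rfl | hT
    · have h0 : condVar 0 e = 0 := by
        rw [condVar, show (0 + e) / 2 = 0 by omega, varianceSeq_zero]
        simp
      rw [h0, centeredChar, condChar_zero he, condMean]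
      simp
    have hD : ∀ e < 2, ‖(Complex.exp (centeredGain T e * θ * Complex.I) *
          Real.exp (-(condVar ((T + e) / 2) 0 * θ ^ 2 / 2)) +
        Complex.exp (-(centeredGain T e * θ * Complex.I)) *
          Real.exp (-(condVar ((T + e) / 2) 1 * θ ^ 2 / 2))) / 2 -
        Real.exp (-(condVar T e * θ ^ 2 / 2))‖ ≤ 300 * |θ| ^ 3 := by
      intro e he
      rw [condVar_eq T he]
      exact norm_gaussian_avg_sub_le (condVar_nonneg _ _) (condVar_nonneg _ _)
        (abs_condVar_sub_le _) (abs_centeredGain_le he) θ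
    have step : ∀ e < 2, (T + e) / 2 < T →
        ‖centeredChar T e θ - Real.exp (-(condVar T e * θ ^ 2 / 2))‖ ≤
          (2400 * condVar T e - if T % 4 = 2 then (300 : ℝ) else 0) * |θ| ^ 3 := by
      intro e he hlt
      have i0 := ih _ hlt 0 two_pos θ
      have i1 := ih _ hlt 1 one_lt_two θ
      have hV := condVar_eq T he
      by_cases hs : T % 2 = 0 ∧ (T + e) / 2 % 2 = 0
      · have hs0 : centeredGain T e = 0 := by
          rw [centeredGain_eq he, if_pos hs.1, if_pos hs.2]
        rw [if_neg (by omega)]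
        rw [hs0] at hV
        -- With zero gain, if the next shift is `2` mod 4 the saved `300` is spent; if it is `0` mod
        -- 4 the two conditional variances coincide and the step is exact.
        by_cases h4 : (T + e) / 2 % 4 = 2
        · rw [if_pos h4] at i0 i1
          refine (norm_centeredChar_sub_le_step T he (r := (2400 * condVar T e - 300) * |θ| ^ 3)
            ((add_le_add i0 i1).trans (le_of_eq ?_)) (hD e he)).trans (le_of_eq ?_)
          · rw [hV]
            ring
          · ring
        · rw [if_neg h4] at i0 i1
          have hVV : condVar ((T + e) / 2) 0 = condVar ((T + e) / 2) 1 := by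
            rw [condVar, condVar, show ((T + e) / 2 + 1) / 2 = ((T + e) / 2 + 0) / 2 by omega,
              if_pos hs.2,
              if_pos hs.2, if_pos (by omega), if_pos (by omega)]
          refine (norm_centeredChar_sub_le_step T he (r := 2400 * condVar T e * |θ| ^ 3) (D := 0)
            ((add_le_add i0 i1).trans (le_of_eq ?_)) ?_).trans (le_of_eq ?_)
          · rw [hV]
            ring
          · rw [hV, hs0, hVV]
            simp
          · ring
      · have hs2 : 1 / 4 ≤ centeredGain T e ^ 2 := by
          rw [centeredGain_eq he]
          interval_cases e <;> split_ifs <;> first | omega | norm_num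
        have hle : ∀ μ, (2400 * condVar ((T + e) / 2) μ -
            if (T + e) / 2 % 4 = 2 then (300 : ℝ) else 0) * |θ| ^ 3 ≤
            2400 * condVar ((T + e) / 2) μ * |θ| ^ 3 := by
          intro μ
          gcongr
          split_ifs <;> norm_num
        refine (norm_centeredChar_sub_le_step T he (r := (2400 * condVar T e - 600) * |θ| ^ 3)
            ((add_le_add (i0.trans (hle 0)) (i1.trans (hle 1))).trans ?_) (hD e he)).trans ?_
        · rw [← add_mul, ← mul_assoc]
          gcongr
          linarith
        · rw [← add_mul]
          gcongr
          split_ifs <;> linarith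
    by_cases hlt : (T + e) / 2 < T
    · exact step e he hlt
    -- The error for `T = e = 1` occurs on both sides, on the right with weight `1 / 2`. Solving for
    -- it bounds it by the error for `e = 0` plus `600 |θ|³`, well below the allowance.
    · obtain ⟨rfl, rfl⟩ : T = 1 ∧ e = 1 := by omega
      have i0 := step 0 two_pos (by omega)
      have h := norm_centeredChar_sub_le_step 1 one_lt_two (θ := θ)
        (le_of_eq (mul_div_cancel₀ _ two_ne_zero).symm) (hD 1 one_lt_two)
      rw [if_neg (by norm_num)] at i0 ⊢
      norm_num at h
      have v0 : condVar 1 0 = 1 / 4 := by norm_num [condVar, varianceSeq_zero]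
      have v1 : condVar 1 1 = 9 / 4 := by norm_num [condVar, varianceSeq_one]
      rw [v0] at i0 h
      rw [v1] at h ⊢
      push_cast at h i0 ⊢
      linarith

/-- The characteristic function of `d(t, n)`. -/
noncomputable def diffChar (t : ℕ) (θ : ℝ) : ℂ := (condChar t 0 θ + condChar t 1 θ) / 2

theorem norm_diffChar_le {θ : ℝ} (hθ : |θ| ≤ Real.pi) (t : ℕ) :
    ‖diffChar t θ‖ ≤ Real.exp (-(θ ^ 2 / 1000) * countZeroOne t) := by
  have h0 := norm_condChar_add_le hθ t 0 two_pos 0 two_pos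
  have h1 := norm_condChar_add_le hθ t 0 two_pos 1 one_lt_two
  rw [diffChar, norm_div, Complex.norm_ofNat]
  have := norm_add_le (condChar t 0 θ) (condChar t 1 θ)
  rw [add_zero] at h0 h1
  linarith

/-- One further averaging step, over the parity of `n` itself; the conditional means are opposite,
so the overall mean is zero. -/
theorem norm_diffChar_sub_le (t : ℕ) (θ : ℝ) :
    ‖diffChar t θ - Real.exp (-(varianceSeq t * θ ^ 2 / 2))‖ ≤
      (2400 * varianceSeq t + 300) * |θ| ^ 3 := by
  have hp : 0 ≤ |θ| ^ 3 := by positivity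
  have hle : ∀ e < 2, ‖centeredChar t e θ - Real.exp (-(condVar t e * θ ^ 2 / 2))‖ ≤
      2400 * condVar t e * |θ| ^ 3 := by
    intro e he
    refine (norm_centeredChar_sub_le t e he θ).trans ?_
    gcongr
    split_ifs <;> norm_num
  have hm : condMean t 1 = -condMean t 0 := by
    rw [condMean, condMean]
    split_ifs <;> norm_num
  have hms : |condMean t 0| ≤ 3 / 2 := by
    rw [condMean]
    split_ifs <;> norm_num [abs_le]
  have hv : varianceSeq t = (condVar t 0 + condVar t 1) / 2 + condMean t 0 ^ 2 := by
    rw [condVar_add, condMean]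
    split_ifs <;> norm_num
  have hd : diffChar t θ = (Complex.exp (condMean t 0 * θ * Complex.I) * centeredChar t 0 θ +
      Complex.exp (-(condMean t 0 * θ * Complex.I)) * centeredChar t 1 θ) / 2 := by
    rw [diffChar, centeredChar, centeredChar, hm, ← mul_assoc, ← mul_assoc, ← Complex.exp_add,
      ← Complex.exp_add]
    push_cast
    ring_nf
    rw [Complex.exp_zero]
    ring
  rw [hd]
  refine (norm_avg_sub_le (r := 2400 * ((condVar t 0 + condVar t 1) / 2) * |θ| ^ 3)
    (norm_exp_ofReal_mul_ofReal_mul_I _ _)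
    (norm_exp_neg_ofReal_mul_ofReal_mul_I _ _) ((add_le_add (hle 0 two_pos) (hle 1 one_lt_two)).trans
      (le_of_eq (by ring))) ?_).trans (?_ : _ + 300 * |θ| ^ 3 ≤ _)
  · rw [hv]
    exact norm_gaussian_avg_sub_le (condVar_nonneg _ _) (condVar_nonneg _ _)
      (abs_condVar_sub_le _) hms θ
  · rw [← add_mul]
    gcongr
    rw [hv]
    nlinarith [sq_nonneg (condMean t 0)]

/-! ### Inversion -/

theorem intervalIntegral_exp_int (m : ℤ) :
    ∫ θ in (-Real.pi)..Real.pi, Complex.exp (m * θ * Complex.I) =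
      if m = 0 then (2 * Real.pi : ℂ) else 0 := by
  split_ifs with hm
  · simp [hm]
    ring
  · have hc : (m * Complex.I : ℂ) ≠ 0 := mul_ne_zero (by exact_mod_cast hm) Complex.I_ne_zero
    have := integral_exp_mul_complex (a := -Real.pi) (b := Real.pi) hc
    simp_rw [mul_right_comm _ _ Complex.I]
    rw [this, div_eq_zero_iff]
    left
    rw [sub_eq_zero, Complex.exp_eq_exp_iff_exists_int]
    refine ⟨m, ?_⟩
    push_cast
    ring

theorem continuous_condChar (T : ℕ) {e : ℕ} (he : e < 2) : Continuous (condChar T e) := by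
  refine continuous_const.mul (continuous_tsum (u := fun k => |levelDensity T e k|) (fun k => ?_)
    (summable_levelDensity T he).abs fun k θ => ?_)
  · fun_prop
  · simp [norm_exp_intCast_mul_ofReal_mul_I]

theorem continuous_diffChar (t : ℕ) : Continuous (diffChar t) :=
  ((continuous_condChar t two_pos).add (continuous_condChar t one_lt_two)).div_const 2

theorem hasSum_diffChar_mul (t : ℕ) (k : ℤ) (θ : ℝ) :
    HasSum (fun j : ℤ => ((levelDensity t 0 j + levelDensity t 1 j : ℝ) : ℂ) *
      Complex.exp ((j - k : ℤ) * θ * Complex.I))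
      (diffChar t θ * Complex.exp (-(k * θ * Complex.I))) := by
  have h0 := (summable_condChar t two_pos θ).hasSum
  have h1 := (summable_condChar t one_lt_two θ).hasSum
  have hd : diffChar t θ = ∑' j : ℤ, (levelDensity t 0 j : ℂ) * Complex.exp (j * θ * Complex.I) +
      ∑' j : ℤ, (levelDensity t 1 j : ℂ) * Complex.exp (j * θ * Complex.I) := by
    rw [diffChar, condChar, condChar]
    ring
  rw [hd]
  have h := (h0.add h1).mul_right (Complex.exp (-(k * θ * Complex.I)))
  simp only [← add_mul, mul_assoc, ← Complex.exp_add, ← Complex.ofReal_add] at h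
  simpa only [sub_eq_add_neg, Int.cast_add, Int.cast_neg, add_mul, neg_mul, mul_assoc] using h

/-- Orthogonality of the exponentials on `[-π, π]`; summability of the densities justifies
integrating term by term. -/
theorem levelDensity_eq_integral (t : ℕ) (k : ℤ) :
    ((levelDensity t 0 k + levelDensity t 1 k : ℝ) : ℂ) = (2 * Real.pi : ℂ)⁻¹ *
      ∫ θ in (-Real.pi)..Real.pi, diffChar t θ * Complex.exp (-(k * θ * Complex.I)) := by
  have key := intervalIntegral.hasSum_integral_of_dominated_convergence
    (μ := MeasureTheory.volume) (a := -Real.pi) (b := Real.pi)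
    (F := fun (j : ℤ) (θ : ℝ) => ((levelDensity t 0 j + levelDensity t 1 j : ℝ) : ℂ) *
      Complex.exp ((j - k : ℤ) * θ * Complex.I))
    (f := fun θ => diffChar t θ * Complex.exp (-(k * θ * Complex.I)))
    (fun j _ => |levelDensity t 0 j + levelDensity t 1 j|)
    (fun j => Continuous.aestronglyMeasurable (by fun_prop))
    (fun j => .of_forall fun θ _ => by
      rw [norm_mul, norm_exp_intCast_mul_ofReal_mul_I, mul_one, Complex.norm_real,
        Real.norm_eq_abs])
    (.of_forall fun θ _ => ((summable_levelDensity t two_pos).add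
      (summable_levelDensity t one_lt_two)).abs)
    intervalIntegrable_const
    (.of_forall fun θ _ => hasSum_diffChar_mul t k θ)
  simp only [intervalIntegral.integral_const_mul, intervalIntegral_exp_int] at key
  have h2 := hasSum_single (f := fun j : ℤ =>
    ((levelDensity t 0 j + levelDensity t 1 j : ℝ) : ℂ) *
      if j - k = 0 then (2 * Real.pi : ℂ) else 0) k
    (fun j hj => by rw [if_neg (sub_ne_zero.2 hj), mul_zero])
  rw [key.unique h2, sub_self, if_pos rfl]
  have : (Real.pi : ℂ) ≠ 0 := by exact_mod_cast Real.pi_ne_zero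
  field_simp

theorem gaussian_eq_integral {v : ℝ} (hv : 0 < v) (k : ℝ) :
    (((Real.sqrt (2 * Real.pi * v))⁻¹ * Real.exp (-(k ^ 2 / (2 * v))) : ℝ) : ℂ) =
      (2 * Real.pi : ℂ)⁻¹ *
        ∫ θ : ℝ, Real.exp (-(v * θ ^ 2 / 2)) * Complex.exp (-(k * θ * Complex.I)) := by
  have h := fourierIntegral_gaussian (b := ((v / 2 : ℝ) : ℂ))
    (by rw [Complex.ofReal_re]; positivity) (-k)
  have h' : ∫ θ : ℝ, (Real.exp (-(v * θ ^ 2 / 2)) : ℂ) * Complex.exp (-(k * θ * Complex.I)) =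
      ∫ θ : ℝ, Complex.exp (Complex.I * (-k) * θ) *
        Complex.exp (-((v / 2 : ℝ) : ℂ) * (θ : ℂ) ^ 2) := by
    congr 1
    ext θ
    push_cast
    rw [mul_comm]
    ring_nf
  have hpow : ((Real.pi : ℂ) / ((v / 2 : ℝ) : ℂ)) ^ (1 / 2 : ℂ) =
      ((Real.sqrt (Real.pi / (v / 2)) : ℝ) : ℂ) := by
    rw [Real.sqrt_eq_rpow, Complex.ofReal_cpow (by positivity)]
    push_cast
    rfl
  have hexp : Complex.exp (-(-(k : ℂ)) ^ 2 / (4 * ((v / 2 : ℝ) : ℂ))) =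
      ((Real.exp (-(k ^ 2 / (2 * v))) : ℝ) : ℂ) := by
    have : (v : ℂ) ≠ 0 := by exact_mod_cast hv.ne'
    push_cast
    congr 1
    field_simp
    ring
  rw [h', h, hpow, hexp, ← mul_assoc]
  norm_cast
  congr 1
  have h2 : Real.sqrt (Real.pi / (v / 2)) = 2 * Real.pi / Real.sqrt (2 * Real.pi * v) := by
    rw [Real.sqrt_eq_iff_mul_self_eq_of_pos (by positivity), div_mul_div_comm,
      Real.mul_self_sqrt (by positivity)]
    field_simp
  rw [h2]
  have : Real.sqrt (2 * Real.pi * v) ≠ 0 := by positivity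
  have := Real.pi_ne_zero
  field_simp

/-! ### The local limit theorem -/

/-- The cutoff is chosen so that `θ² N / 1000 ≥ log N`; then both functions are at most `1 / N`. -/
theorem norm_diffChar_sub_le_of_cutoff {t : ℕ} {θ : ℝ} (hN : 3 ≤ countZeroOne t)
    (hθ : |θ| ≤ Real.pi)
    (hρ : 1000 * Real.log (countZeroOne t) / countZeroOne t ≤ θ ^ 2) :
    ‖diffChar t θ - Real.exp (-(varianceSeq t * θ ^ 2 / 2))‖ ≤ 2 / countZeroOne t := by
  have hN' : (3 : ℝ) ≤ countZeroOne t := by exact_mod_cast hN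
  have hv := countZeroOne_le_varianceSeq t
  have hlog : 0 ≤ Real.log (countZeroOne t) := Real.log_nonneg (by linarith)
  rw [div_le_iff₀ (by linarith)] at hρ
  have hinv : Real.exp (-Real.log (countZeroOne t)) = 1 / countZeroOne t := by
    rw [Real.exp_neg, Real.exp_log (by linarith), one_div]
  have h1 : ‖diffChar t θ‖ ≤ 1 / countZeroOne t := by
    refine (norm_diffChar_le hθ t).trans ?_
    rw [← hinv]
    refine Real.exp_le_exp.2 ?_
    linarith
  have h2 : ‖(Real.exp (-(varianceSeq t * θ ^ 2 / 2)) : ℂ)‖ ≤ 1 / countZeroOne t := by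
    rw [Complex.norm_real, Real.norm_eq_abs, Real.abs_exp, ← hinv]
    refine Real.exp_le_exp.2 ?_
    nlinarith [sq_nonneg θ]
  refine (norm_sub_le _ _).trans ((add_le_add h1 h2).trans (le_of_eq ?_))
  ring

theorem exp_neg_mul_pi_sq_mul_sqrt_le {t : ℕ} (hN : 3 ≤ countZeroOne t) :
    Real.exp (-(varianceSeq t * Real.pi ^ 2 / 4)) * Real.sqrt (Real.pi / (varianceSeq t / 4)) ≤
      4 / countZeroOne t := by
  have hN' : (3 : ℝ) ≤ countZeroOne t := by exact_mod_cast hN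
  have hv := countZeroOne_le_varianceSeq t
  have hv0 : 0 < varianceSeq t := by linarith
  have hpi := Real.pi_gt_three
  have h1 : Real.exp (-(varianceSeq t * Real.pi ^ 2 / 4)) ≤ 4 / 3 / countZeroOne t := by
    have hx : varianceSeq t ≤ varianceSeq t * Real.pi ^ 2 / 4 := by
      have : 4 ≤ Real.pi ^ 2 := by nlinarith
      nlinarith
    have h := Real.add_one_le_exp (varianceSeq t * Real.pi ^ 2 / 4)
    rw [Real.exp_neg, inv_eq_one_div, div_le_div_iff₀ (Real.exp_pos _) (by linarith)]
    linarith
  have h2 : Real.sqrt (Real.pi / (varianceSeq t / 4)) ≤ 3 := by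
    refine Real.sqrt_le_iff.2 ⟨by norm_num, ?_⟩
    rw [div_le_iff₀ (by linarith)]
    nlinarith [Real.pi_lt_four]
  calc _ ≤ 4 / 3 / (countZeroOne t : ℝ) * 3 := by gcongr
    _ = _ := by ring

theorem integrable_gaussian_mul_exp {v : ℝ} (hv : 0 < v) (k : ℝ) :
    MeasureTheory.Integrable fun θ : ℝ =>
      (Real.exp (-(v * θ ^ 2 / 2)) : ℂ) * Complex.exp (-(k * θ * Complex.I)) := by
  have h : MeasureTheory.Integrable fun θ : ℝ => Real.exp (-(v / 2) * θ ^ 2) :=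
    integrable_exp_neg_mul_sq (by positivity)
  refine h.mono' (Continuous.aestronglyMeasurable (by fun_prop)) (.of_forall fun θ => ?_)
  rw [norm_mul, norm_exp_neg_ofReal_mul_ofReal_mul_I, mul_one, Complex.norm_real, Real.norm_eq_abs,
    Real.abs_exp]
  refine le_of_eq ?_
  ring_nf

theorem norm_integral_diffChar_sub_le {t : ℕ} (hN : 3 ≤ countZeroOne t) (k : ℤ) :
    ‖(∫ θ in (-Real.pi)..Real.pi, diffChar t θ * Complex.exp (-(k * θ * Complex.I))) -
      ∫ θ : ℝ, Real.exp (-(varianceSeq t * θ ^ 2 / 2)) *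
        Complex.exp (-((k : ℝ) * θ * Complex.I))‖ ≤
      10 ^ 11 * Real.log (countZeroOne t) ^ 2 / countZeroOne t := by
  have hN' : (3 : ℝ) ≤ countZeroOne t := by exact_mod_cast hN
  have hv := countZeroOne_le_varianceSeq t
  have hv' := varianceSeq_le t
  have htail := exp_neg_mul_pi_sq_mul_sqrt_le hN
  have hcut := fun θ => norm_diffChar_sub_le_of_cutoff (θ := θ) hN
  set N : ℝ := (countZeroOne t : ℝ) with hNdef
  set v := varianceSeq t with hvdef
  have hv0 : 0 < v := by linarith
  have hpi := Real.pi_pos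
  have hlog : 1 ≤ Real.log N := by
    rw [Real.le_log_iff_exp_le (by linarith)]
    linarith [Real.exp_one_lt_d9]
  set ρ : ℝ := 1000 * Real.log N / N with hρdef
  have hρ : 0 ≤ ρ := by positivity
  -- For `N ≥ 3` the upper bound on `v` gives `2400 v + 300 ≤ 15000 N`.
  set a : ℝ := 15000 * N * Real.sqrt ρ ^ 3 with ha
  -- An integrable majorant with one summand each for the inner range, the rest of `[-π, π]`, and
  -- the Gaussian tail. All are nonnegative, so it does no harm if `√ρ` exceeds `π`.
  set B : ℝ → ℝ := fun θ => (Set.Icc (-Real.sqrt ρ) (Real.sqrt ρ)).indicator (fun _ => a) θ +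
    (Set.Ioc (-Real.pi) Real.pi).indicator (fun _ => 2 / N) θ +
    Real.exp (-(v * Real.pi ^ 2 / 4)) * Real.exp (-(v / 4) * θ ^ 2) with hB
  have hi1 : MeasureTheory.Integrable
      ((Set.Icc (-Real.sqrt ρ) (Real.sqrt ρ)).indicator fun _ : ℝ => a) :=
    (MeasureTheory.integrable_indicator_iff measurableSet_Icc).2
      (MeasureTheory.integrableOn_const (by simp))
  have hi2 : MeasureTheory.Integrable
      ((Set.Ioc (-Real.pi) Real.pi).indicator fun _ : ℝ => 2 / N) :=
    (MeasureTheory.integrable_indicator_iff measurableSet_Ioc).2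
      (MeasureTheory.integrableOn_const (by simp))
  have hi3 : MeasureTheory.Integrable fun θ : ℝ =>
      Real.exp (-(v * Real.pi ^ 2 / 4)) * Real.exp (-(v / 4) * θ ^ 2) :=
    (integrable_exp_neg_mul_sq (by positivity)).const_mul _
  have hBint : MeasureTheory.Integrable B := (hi1.add hi2).add hi3
  have hBval : ∫ θ, B θ = 2 * Real.sqrt ρ * a + 2 * Real.pi * (2 / N) +
      Real.exp (-(v * Real.pi ^ 2 / 4)) * Real.sqrt (Real.pi / (v / 4)) := by
    have hs := Real.sqrt_nonneg ρ
    refine (MeasureTheory.integral_add (hi1.add hi2) hi3).trans ?_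
    rw [MeasureTheory.integral_add' hi1 hi2,
      MeasureTheory.integral_indicator_const _ measurableSet_Icc,
      MeasureTheory.integral_indicator_const _ measurableSet_Ioc, MeasureTheory.integral_const_mul,
      integral_gaussian, Real.volume_real_Icc_of_le (by linarith),
      Real.volume_real_Ioc_of_le (by linarith), smul_eq_mul, smul_eq_mul]
    ring
  rw [intervalIntegral.integral_of_le (by linarith),
    ← MeasureTheory.integral_indicator measurableSet_Ioc, ← MeasureTheory.integral_sub
      ((MeasureTheory.integrable_indicator_iff measurableSet_Ioc).2 ?_)
      (integrable_gaussian_mul_exp hv0 k)]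
  · refine (MeasureTheory.norm_integral_le_of_norm_le hBint (.of_forall fun θ => ?_)).trans ?_
    · have ha0 : 0 ≤ (Set.Icc (-Real.sqrt ρ) (Real.sqrt ρ)).indicator (fun _ => a) θ :=
        Set.indicator_nonneg (fun _ _ => by positivity) θ
      have hE : 0 ≤ Real.exp (-(v * Real.pi ^ 2 / 4)) * Real.exp (-(v / 4) * θ ^ 2) := by
        positivity
      by_cases hθ : θ ∈ Set.Ioc (-Real.pi) Real.pi
      · have habs : |θ| ≤ Real.pi := abs_le.2 ⟨hθ.1.le, hθ.2⟩
        have heq : diffChar t θ * Complex.exp (-(k * θ * Complex.I)) -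
            Real.exp (-(v * θ ^ 2 / 2)) * Complex.exp (-((k : ℝ) * θ * Complex.I)) =
            (diffChar t θ - Real.exp (-(v * θ ^ 2 / 2))) *
              Complex.exp (-((k : ℝ) * θ * Complex.I)) := by
          push_cast
          ring
        rw [Set.indicator_of_mem hθ, heq, norm_mul, norm_exp_neg_ofReal_mul_ofReal_mul_I, mul_one,
          hB]
        simp only
        rw [Set.indicator_of_mem hθ]
        by_cases hc : |θ| ≤ Real.sqrt ρ
        · rw [Set.indicator_of_mem (Set.mem_Icc.2 (abs_le.1 hc))]
          have h1 : ‖diffChar t θ - Real.exp (-(v * θ ^ 2 / 2))‖ ≤ a := by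
            refine (norm_diffChar_sub_le t θ).trans ?_
            rw [ha]
            gcongr
            linarith
          have : 0 ≤ 2 / N := by positivity
          linarith
        · have h1 : ρ ≤ θ ^ 2 := by
            rw [← sq_abs]
            exact Real.sqrt_le_left (abs_nonneg θ) |>.1 (not_le.1 hc).le
          linarith [hcut θ habs h1]
      · have h1 : Real.pi ^ 2 ≤ θ ^ 2 := by
          rw [Set.mem_Ioc, not_and_or, not_lt, not_le] at hθ
          rcases hθ with h | h <;> nlinarith
        rw [Set.indicator_of_notMem hθ, zero_sub, norm_neg, norm_mul,
          norm_exp_neg_ofReal_mul_ofReal_mul_I, mul_one, Complex.norm_real, Real.norm_eq_abs,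
          Real.abs_exp, hB]
        simp only
        rw [Set.indicator_of_notMem hθ, ← Real.exp_add]
        -- Half of the exponent is bounded using `θ² ≥ π²` to gain smallness; the other half is kept
        -- for integrability.
        have h2 : Real.exp (-(v * θ ^ 2 / 2)) ≤
            Real.exp (-(v * Real.pi ^ 2 / 4) + -(v / 4) * θ ^ 2) :=
          Real.exp_le_exp.2 (by nlinarith)
        linarith
    · rw [hBval]
      have h1 : 2 * Real.sqrt ρ * a = 3 * 10 ^ 10 * (Real.log N ^ 2 / N) := by
        have : Real.sqrt ρ ^ 4 = ρ ^ 2 := by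
          rw [show 4 = 2 * 2 by norm_num, pow_mul, Real.sq_sqrt hρ]
        rw [ha, show 2 * Real.sqrt ρ * (15000 * N * Real.sqrt ρ ^ 3) =
          30000 * N * Real.sqrt ρ ^ 4 by ring, this, hρdef]
        field_simp
        norm_num
      have h2 : 1 / N ≤ Real.log N ^ 2 / N := by
        gcongr
        nlinarith
      have h3 : 2 * Real.pi * (2 / N) ≤ 16 * (1 / N) := by
        rw [show 2 * Real.pi * (2 / N) = 4 * Real.pi * (1 / N) by ring]
        gcongr
        linarith [Real.pi_lt_four]
      have h4 : 4 / N = 4 * (1 / N) := by ring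
      have h5 : 0 ≤ Real.log N ^ 2 / N := by positivity
      rw [mul_div_assoc (10 ^ 11 : ℝ)]
      linarith
  · refine (Continuous.integrableOn_Icc ?_).mono_set Set.Ioc_subset_Icc_self
    exact (continuous_diffChar t).mul (by fun_prop)

theorem mainTheorem1 :
    ∃ c : ℕ → ℤ → ℝ,
      (∀ (t : ℕ) (k : ℤ), HasAsymptoticDensity {n : ℕ | blockDiff t n = k} (c t k)) ∧
      ∃ C N₀ : ℕ, ∀ t : ℕ, N₀ ≤ countZeroOne t → ∀ k : ℤ,
        |c t k - (Real.sqrt (2 * Real.pi * varianceSeq t))⁻¹ *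
            Real.exp (-((k : ℝ) ^ 2 / (2 * varianceSeq t)))| ≤
          (C : ℝ) * (Real.log (countZeroOne t : ℝ)) ^ 2 / (countZeroOne t : ℝ) := by
  refine ⟨fun t k => levelDensity t 0 k + levelDensity t 1 k, hasAsymptoticDensity_blockDiff,
    10 ^ 11, 3, fun t hN k => ?_⟩
  have hN' : (3 : ℝ) ≤ countZeroOne t := by exact_mod_cast hN
  have hv : 0 < varianceSeq t := by linarith [countZeroOne_le_varianceSeq t]
  rw [← Real.norm_eq_abs, ← Complex.norm_real, Complex.ofReal_sub, levelDensity_eq_integral,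
    gaussian_eq_integral hv, ← mul_sub, norm_mul]
  have h2 : ‖(2 * Real.pi : ℂ)⁻¹‖ ≤ 1 := by
    rw [norm_inv, norm_mul, Complex.norm_ofNat, Complex.norm_real, Real.norm_eq_abs,
      abs_of_pos Real.pi_pos]
    exact inv_le_one_of_one_le₀ (by linarith [Real.pi_gt_three])
  refine (mul_le_mul h2 (norm_integral_diffChar_sub_le hN k) (norm_nonneg _) zero_le_one).trans ?_
  rw [one_mul]
  norm_num
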